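/- Let $X=\mathbb Z_2^{\infty}$ be the group of sequences $x=(x_1,x_2,\dots)$ of $0$'s and $1$'s under componentwise addition modulo $2$, with its product $\sigma$-algebra; let $\delta^k\in X$ have its only $1$ at position $k$, let $\Delta\subset X$ be the subgroup of sequences with finitely many $1$'s, and let $\check x=x+\mathbf 1$, where $\mathbf 1=(1,1,\dots)$. A Gårding–Wightman triple $(\mu,\mathcal V,\mathcal C)$ consists of - a $\sigma$-finite positive measure $\mu$ on $X$ that is quasi-invariant under the translations by $\Delta$ (each translate $\mu(\cdot+d)$, $d\in\Delta$, has the same null sets as $\mu$); - a measurable field $\mathcal V=(V_x)_{x\in X}$ of closed subspaces of a separable complex Hilbert space $K$ such that $V_{x+d}=V_x$ for every $d\in\Delta$ and almost all $x$, such that $V_x\neq 0$ for almost all $x$, and such that $\nu(x)=\dim V_x\in\{0,1,2,\dots,\infty\}$ is measurable; - a family $\mathcal C$ of unitary operators $c_k(x):V_{x+\delta^k}=V_x\to V_x$ ($k\ge 1$), depending measurably on $x$, such that, for all $k,l$ and almost all $x$, $$c_k(x)^*=c_k(x+\delta^k),\qquad c_k(x)\,c_l(x+\delta^k)=c_l(x)\,c_k(x+\delta^l).$$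 Let $V=V(\mu,\nu,\mathcal C)=\int_X^{\oplus}V_x\,d\mu(x)$, i.e. the space of all $f\in L^2(X,\mu;K)$ with $f(x)\in V_x$ for almost all $x$, and define on $V$ the operators $$J_kf(x)=-i(-1)^{x_1+\dots+x_{k-1}}\,c_k(x)\Big(\sqrt{\tfrac{d\mu(x+\delta^k)}{d\mu(x)}}\,f(x+\delta^k)\Big),\qquad J_k'f(x)=(-1)^{x_1+\dots+x_k}\,c_k(x)\Big(\sqrt{\tfrac{d\mu(x+\delta^k)}{d\mu(x)}}\,f(x+\delta^k)\Big),$$ where $d\mu(x+\delta^k)/d\mu(x)$ is the Radon–Nikodym derivative with respect to $\mu$ of the measure $A\mapsto\mu(A+\delta^k)$. An invariant real form of $V$ is a set $\{f\in V: Sf=f\}$, where $S:V\to V$ is a charge conjugation: a $\mathbb C$-antilinear operator with $S^2=1$ and $\|Sf\|=\|f\|$ for all $f\in V$ that commutes with all the $J_k$ and $J_k'$. **Theorem 3.2.** $V(\mu,\nu,\mathcal C)$ admits an invariant real form if and only if the following three conditions hold. 1. The measures $\mu$ and $\check\mu$ are equivalent (have the same null sets), where $\check\mu(A)=\mu(\{\check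 x:x\in A\})$. 2. $\nu(\check x)=\nu(x)$ for almost all $x\in X$. 3. There is a family of $\mathbb C$-antilinear norm-preserving operators $r(x):V_{\check x}\to V_x$, depending measurably on $x$, such that, for all $k\ge 1$ and almost all $x\in X$, $$r(x)\,r(\check x)=1,\qquad r(x)\,c_k(\check x)=(-1)^k\,c_k(x)\,r(x+\delta^k).$$ -/

import Mathlib

open MeasureTheory
open scoped ENNReal

noncomputable section

namespace GardingWightman

/-! ### The group of binary sequences -/

/-- The group `X = ℤ₂^∞` of sequences `x = (x₁, x₂, …)` of `0`'s and `1`'s, with componentwise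
addition modulo `2`. Its (product) `σ`-algebra is the Borel `σ`-algebra of the product topology. -/
abbrev X : Type := ℕ+ → ZMod 2

/-- The sequence `δ^k` whose only nonzero entry is a `1` at the position `k`. -/
def delta (k : ℕ+) : X := Pi.single k 1

/-- The subgroup `Δ` of the sequences with only finitely many `1`'s. -/
def Delta : AddSubgroup X where
  carrier := {x | {k | x k ≠ 0}.Finite}
  zero_mem' := by simp
  add_mem' := by
    intro a b ha hb
    refine (ha.union hb).subset fun k hk => ?_
    by_contra h
    simp only [Set.mem_union, Set.mem_ofPred_eq, not_or, not_not] at h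
    exact hk (by simp [h.1, h.2])
  neg_mem' := by
    intro a ha
    simpa using ha

/-- The flip `x ↦ x̌ = x + 𝟏`, which exchanges all `0`'s and `1`'s. -/
def flipSeq (x : X) : X := x + 1

/-- `s_k(x) = x₁ + ⋯ + x_k` (a sum of natural numbers; only its parity matters). -/
def partialSum (k : ℕ+) (x : X) : ℕ := ∑ j ∈ Finset.Iic k, (x j).val

/-- `s_{k-1}(x) = x₁ + ⋯ + x_{k-1}` (the empty sum for `k = 1`). -/
def partialSumBefore (k : ℕ+) (x : X) : ℕ := ∑ j ∈ Finset.Iio k, (x j).val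

/-- Two measures are equivalent when each one is absolutely continuous with respect to the other
(for `σ`-finite measures: when each one has a density with respect to the other). -/
def EquivMeasure (μ μ' : Measure X) : Prop := μ ≪ μ' ∧ μ' ≪ μ

/-- The translated measure `A ↦ μ (A + d)`. Since `d + d = 0`, this is the image of `μ` under
`x ↦ x + d`. -/
def translate (d : X) (μ : Measure X) : Measure X := μ.map (fun x => x + d)

/-- The flipped measure `μ̌ : A ↦ μ (Ǎ)`, i.e. the image of `μ` under the involution `x ↦ x̌`. -/
def flipMeasure (μ : Measure X) : Measure X := μ.map flipSeq

variable {K : Type*} [NormedAddCommGroup K] [InnerProductSpace ℂ K] [CompleteSpace K]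

/-! ### Gårding–Wightman triples -/

variable (K) in
/-- A Gårding–Wightman triple `(μ, 𝒱, 𝒞)`. The Hilbert spaces `V_x` form a measurable field of
closed subspaces of an ambient separable Hilbert space `K`. The unitary operator `c_k(x)`, which
maps `V_{x+δ^k} = V_x` onto `V_x`, is extended by `0` to the orthogonal complement: it is the partial
isometry of `K` with initial space `V_{x+δ^k}` and final space `V_x`. -/
structure Triple where
  /-- The measure `μ` on `X`. -/
  μ : Measure X
  sigmaFinite : SigmaFinite μ
  /-- `μ` is quasi-invariant under the translations by elements of `Δ`. -/
  quasiInvariant : ∀ d ∈ Delta, EquivMeasure (translate d μ) μ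
  /-- The Hilbert space `V_x`. -/
  fiber : X → ClosedSubmodule ℂ K
  /-- `x ↦ V_x` is a measurable field: the orthogonal projections depend measurably on `x`. -/
  measurable_fiber : ∀ v : K, StronglyMeasurable fun x => (fiber x).starProjection v
  /-- The field is a.e. invariant under the translations by elements of `Δ`. -/
  fiber_add : ∀ d ∈ Delta, ∀ᵐ x ∂μ, fiber (x + d) = fiber x
  /-- Almost all the spaces `V_x` are nonzero. -/
  fiber_ne_bot : ∀ᵐ x ∂μ, fiber x ≠ ⊥
  /-- `ν(x) = dim V_x`, an element of `{1, 2, …, ∞}`, is measurable. -/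
  measurable_dim : Measurable fun x => Cardinal.toENat (Module.rank ℂ (fiber x))
  /-- The operators `c_k(x)`. -/
  c : ℕ+ → X → K →L[ℂ] K
  measurable_c : ∀ k, ∀ v : K, StronglyMeasurable fun x => c k x v
  /-- `c_k(x)* c_k(x)` is the identity of `V_{x+δ^k}` (extended by `0`). -/
  star_c_mul_c : ∀ k, ∀ᵐ x ∂μ, star (c k x) * c k x = (fiber (x + delta k)).starProjection
  /-- `c_k(x) c_k(x)*` is the identity of `V_x` (extended by `0`). -/
  c_mul_star_c : ∀ k, ∀ᵐ x ∂μ, c k x * star (c k x) = (fiber x).starProjection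
  /-- `c_k*(x) = c_k(x+δ^k)`. -/
  star_c : ∀ k, ∀ᵐ x ∂μ, star (c k x) = c k (x + delta k)
  /-- `c_k(x) c_l(x+δ^k) = c_l(x) c_k(x+δ^l)`. -/
  c_comm : ∀ k l, ∀ᵐ x ∂μ, c k x * c l (x + delta k) = c l x * c k (x + delta l)

attribute [instance] Triple.sigmaFinite

/-- The dimension function `ν(x) = dim V_x`, with values in `ℕ ∪ {∞}`. -/
def Triple.ν (T : Triple K) (x : X) : ℕ∞ := Cardinal.toENat (Module.rank ℂ (T.fiber x))

/-- The direct integral `V(μ, ν, 𝒞) = ∫^⊕ V_x dμ(x)`: the space of (classes of) square integrable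
functions `f : X → K` such that `f(x) ∈ V_x` for almost all `x`, a closed subspace of
`L²(X, μ; K)`. -/
def Triple.V (T : Triple K) : Submodule ℂ (Lp K 2 T.μ) where
  carrier := {f | ∀ᵐ x ∂T.μ, f x ∈ T.fiber x}
  zero_mem' := by
    filter_upwards [Lp.coeFn_zero K 2 T.μ] with x hx
    rw [hx]
    exact zero_mem (T.fiber x).toSubmodule
  add_mem' := by
    intro f g hf hg
    filter_upwards [hf, hg, Lp.coeFn_add f g] with x h1 h2 h3
    rw [h3]
    exact add_mem (S := Submodule ℂ K) h1 h2
  smul_mem' := by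
    intro a f hf
    filter_upwards [hf, Lp.coeFn_smul a f] with x h1 h2
    rw [h2]
    exact (T.fiber x).toSubmodule.smul_mem a h1

/-! ### The operators `J_k` and `J_k'` -/

/-- `√(dμ(x+δ^k)/dμ(x))`. -/
def Triple.density (T : Triple K) (k : ℕ+) (x : X) : ℝ :=
  √((translate (delta k) T.μ).rnDeriv T.μ x).toReal

/-- The function `x ↦ φ(x) c_k(x) (√(dμ(x+δ^k)/dμ(x)) f(x+δ^k))`. -/
def Triple.shiftFun (T : Triple K) (φ : X → ℂ) (k : ℕ+) (f : X → K) (x : X) : K :=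
  φ x • T.c k x ((T.density k x : ℂ) • f (x + delta k))

lemma delta_mem (k : ℕ+) : delta k ∈ Delta := by
  refine (Set.finite_singleton k).subset fun j hj => ?_
  by_contra h
  exact hj (by simp [delta, show j ≠ k from h])

lemma add_delta_add_delta (x : X) (k : ℕ+) : x + delta k + delta k = x := by
  funext j
  simp [add_assoc, CharTwo.add_self_eq_zero]

lemma measurable_add_delta (k : ℕ+) : Measurable fun x : X => x + delta k :=
  measurable_id.add_const _

lemma Triple.quasiMeasurePreserving (T : Triple K) (k : ℕ+) :
    Measure.QuasiMeasurePreserving (fun x : X => x + delta k) T.μ T.μ :=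
  ⟨measurable_add_delta k, (T.quasiInvariant _ (delta_mem k)).1⟩

instance (d : X) (μ : Measure X) [SigmaFinite μ] : SigmaFinite (translate d μ) :=
  (MeasurableEquiv.addRight d).sigmaFinite_map

lemma norm_le_of_star_mul {c : K →L[ℂ] K} {W : ClosedSubmodule ℂ K}
    (h : star c * c = W.starProjection) (v : K) : ‖c v‖ ≤ ‖v‖ := by
  have h1 : ‖star c * c‖ ≤ 1 := by
    rw [h]; exact Submodule.starProjection_norm_le _
  rw [CStarRing.norm_star_mul_self] at h1
  have h2 : ‖c‖ ≤ 1 := by nlinarith [norm_nonneg c]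
  simpa using c.le_of_opNorm_le h2 v

lemma mem_of_mul_star {c : K →L[ℂ] K} {W : ClosedSubmodule ℂ K}
    (h : c * star c = W.starProjection) (v : K) : c v ∈ W := by
  set p : K →L[ℂ] K := W.starProjection with hp
  have hs : star p = p := (isSelfAdjoint_starProjection W.toSubmodule).star_eq
  have hi : p * p = p := (Submodule.isIdempotentElem_starProjection W.toSubmodule)
  have h0 : (1 - p) * c = 0 := by
    rw [← CStarRing.mul_star_self_eq_zero_iff, star_mul, star_sub, star_one, hs]
    calc (1 - p) * c * (star c * (1 - p)) = (1 - p) * (c * star c) * (1 - p) := by noncomm_ring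
      _ = 0 := by rw [h, sub_mul, one_mul, hi, sub_self, zero_mul]
  have h1 : c v = p (c v) := by
    have := congrArg (fun A : K →L[ℂ] K => A v) h0
    simpa [sub_eq_zero] using this
  rw [h1]
  exact Submodule.starProjection_apply_mem W.toSubmodule _

section

variable [SecondCountableTopology K] (T : Triple K)

lemma Triple.stronglyMeasurable_c_apply (k : ℕ+) {g : X → K} (hg : StronglyMeasurable g) :
    StronglyMeasurable fun x => T.c k x (g x) := by
  borelize K
  have h := stronglyMeasurable_uncurry_of_continuous_of_stronglyMeasurable
    (u := fun (v : K) (x : X) => T.c k x v) (fun x => (T.c k x).continuous) (T.measurable_c k)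
  exact h.comp_measurable (hg.measurable.prodMk measurable_id)

lemma Triple.shiftFun_memLp {φ : X → ℂ} (hφ : Measurable φ) (hφ1 : ∀ x, ‖φ x‖ = 1) (k : ℕ+)
    (f : Lp K 2 T.μ) : MemLp (T.shiftFun φ k f) 2 T.μ := by
  have hm := Lp.stronglyMeasurable f
  have hs : StronglyMeasurable (T.shiftFun φ k f) := by
    refine hφ.stronglyMeasurable.smul (T.stronglyMeasurable_c_apply k ?_)
    refine StronglyMeasurable.smul ?_ (hm.comp_measurable (measurable_add_delta k))
    refine (Complex.measurable_ofReal.comp ?_).stronglyMeasurable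
    exact (Measure.measurable_rnDeriv _ _).ennreal_toReal.sqrt
  refine ⟨hs.aestronglyMeasurable, ?_⟩
  rw [eLpNorm_lt_top_iff_lintegral_rpow_enorm_lt_top (by simp) (by simp)]
  have hf := (eLpNorm_lt_top_iff_lintegral_rpow_enorm_lt_top (by simp) (by simp)).1
    (Lp.memLp f).2
  refine lt_of_le_of_lt ?_ hf
  have hb : ∀ᵐ x ∂T.μ, ‖T.shiftFun φ k f x‖ₑ ^ (2 : ℝ≥0∞).toReal ≤
      (translate (delta k) T.μ).rnDeriv T.μ x *
        ‖f (x + delta k)‖ₑ ^ (2 : ℝ≥0∞).toReal := by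
    filter_upwards [T.star_c_mul_c k, Measure.rnDeriv_lt_top (translate (delta k) T.μ) T.μ]
      with x h1 h2
    have h3 : ‖T.shiftFun φ k f x‖ₑ ≤ ‖T.density k x‖ₑ * ‖f (x + delta k)‖ₑ := by
      have : ‖T.shiftFun φ k f x‖ ≤ ‖T.density k x‖ * ‖f (x + delta k)‖ := by
        rw [Triple.shiftFun, norm_smul, hφ1, one_mul]
        refine (norm_le_of_star_mul h1 _).trans ?_
        rw [norm_smul, Complex.norm_real]
      rw [← ofReal_norm, ← ofReal_norm, ← ofReal_norm, ← ENNReal.ofReal_mul (norm_nonneg _)]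
      exact ENNReal.ofReal_le_ofReal this
    refine (ENNReal.rpow_le_rpow h3 (by simp)).trans ?_
    rw [ENNReal.mul_rpow_of_nonneg _ _ (by simp)]
    gcongr
    rw [Triple.density, Real.enorm_of_nonneg (Real.sqrt_nonneg _)]
    simp only [ENNReal.toReal_ofNat, ENNReal.rpow_ofNat]
    rw [← ENNReal.ofReal_pow (Real.sqrt_nonneg _), Real.sq_sqrt ENNReal.toReal_nonneg,
      ENNReal.ofReal_toReal h2.ne]
  refine (lintegral_mono_ae hb).trans ?_
  have hme : Measurable fun x : X => ‖f x‖ₑ ^ (2 : ℝ≥0∞).toReal := hm.enorm.pow_const _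
  have he := lintegral_rnDeriv_mul (f := fun x : X => ‖f (x + delta k)‖ₑ ^ (2 : ℝ≥0∞).toReal)
    (T.quasiInvariant _ (delta_mem k)).1
    (hme.comp (measurable_add_delta k)).aemeasurable
  have hm2 := lintegral_map (μ := T.μ)
    (f := fun x : X => ‖f (x + delta k)‖ₑ ^ (2 : ℝ≥0∞).toReal)
    (hme.comp (measurable_add_delta k)) (measurable_add_delta k)
  rw [he, translate, hm2]
  simp only [add_delta_add_delta, le_refl]

lemma Triple.shiftFun_mem {φ : X → ℂ} (hφ : Measurable φ) (hφ1 : ∀ x, ‖φ x‖ = 1) (k : ℕ+)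
    (f : Lp K 2 T.μ) : (T.shiftFun_memLp hφ hφ1 k f).toLp ∈ T.V := by
  change ∀ᵐ x ∂T.μ, _ ∈ T.fiber x
  filter_upwards [MemLp.coeFn_toLp (T.shiftFun_memLp hφ hφ1 k f), T.c_mul_star_c k,
    T.star_c_mul_c k, T.fiber_add _ (delta_mem k)] with x h1 h2 h3 h4
  rw [h1]
  refine (T.fiber x).toSubmodule.smul_mem _ ?_
  exact mem_of_mul_star h2 _

/-- The operator `f ↦ (x ↦ φ(x) c_k(x) (√(dμ(x+δ^k)/dμ(x)) f(x+δ^k)))` on `V(μ, ν, 𝒞)`, for a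
measurable function `φ` of modulus `1`. -/
def Triple.shift {φ : X → ℂ} (hφ : Measurable φ) (hφ1 : ∀ x, ‖φ x‖ = 1) (k : ℕ+) :
    T.V →ₗ[ℂ] T.V where
  toFun f := ⟨(T.shiftFun_memLp hφ hφ1 k (f : Lp K 2 T.μ)).toLp, T.shiftFun_mem hφ hφ1 k _⟩
  map_add' f g := by
    apply Subtype.ext
    change (T.shiftFun_memLp hφ hφ1 k ((f + g : T.V) : Lp K 2 T.μ)).toLp =
      (T.shiftFun_memLp hφ hφ1 k (f : Lp K 2 T.μ)).toLp +
        (T.shiftFun_memLp hφ hφ1 k (g : Lp K 2 T.μ)).toLp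
    rw [← MemLp.toLp_add, MemLp.toLp_eq_toLp_iff]
    filter_upwards [(T.quasiMeasurePreserving k).ae (Lp.coeFn_add (f : Lp K 2 T.μ) g)] with x hx
    simp only [Triple.shiftFun, Pi.add_apply, Submodule.coe_add, hx, smul_add, map_add]
  map_smul' a f := by
    apply Subtype.ext
    change (T.shiftFun_memLp hφ hφ1 k ((a • f : T.V) : Lp K 2 T.μ)).toLp =
      a • (T.shiftFun_memLp hφ hφ1 k (f : Lp K 2 T.μ)).toLp
    rw [← MemLp.toLp_const_smul, MemLp.toLp_eq_toLp_iff]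
    filter_upwards [(T.quasiMeasurePreserving k).ae (Lp.coeFn_smul a (f : Lp K 2 T.μ))] with x hx
    simp only [Triple.shiftFun, Pi.smul_apply, Submodule.coe_smul, hx, map_smul]
    simp only [smul_smul]
    congr 1
    ring

/-- The value of `shift` at almost every point. -/
lemma Triple.coe_shift {φ : X → ℂ} (hφ : Measurable φ) (hφ1 : ∀ x, ‖φ x‖ = 1) (k : ℕ+)
    (f : T.V) : ((T.shift hφ hφ1 k f : T.V) : Lp K 2 T.μ) =ᵐ[T.μ]
      T.shiftFun φ k (f : Lp K 2 T.μ) :=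
  MemLp.coeFn_toLp (T.shiftFun_memLp hφ hφ1 k _)

/-- The phase `-i (-1)^{x₁ + ⋯ + x_{k-1}}`. -/
def phaseJ (k : ℕ+) (x : X) : ℂ := -Complex.I * (-1) ^ partialSumBefore k x

/-- The phase `(-1)^{x₁ + ⋯ + x_k}`. -/
def phaseJ' (k : ℕ+) (x : X) : ℂ := (-1) ^ partialSum k x

lemma measurable_val (j : ℕ+) : Measurable fun x : X => (x j).val :=
  (measurable_of_finite _).comp (measurable_pi_apply j)

lemma measurable_phaseJ (k : ℕ+) : Measurable (phaseJ k) :=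
  ((measurable_of_countable fun n : ℕ => (-Complex.I * (-1) ^ n : ℂ))).comp
    (Finset.measurable_fun_sum _ fun j _ => measurable_val j)

lemma measurable_phaseJ' (k : ℕ+) : Measurable (phaseJ' k) :=
  ((measurable_of_countable fun n : ℕ => ((-1) ^ n : ℂ))).comp
    (Finset.measurable_fun_sum _ fun j _ => measurable_val j)

lemma norm_phaseJ (k : ℕ+) (x : X) : ‖phaseJ k x‖ = 1 := by simp [phaseJ]

lemma norm_phaseJ' (k : ℕ+) (x : X) : ‖phaseJ' k x‖ = 1 := by simp [phaseJ']

/-- `J_k f(x) = -i (-1)^{x₁+⋯+x_{k-1}} c_k(x) (√(dμ(x+δ^k)/dμ(x)) f(x+δ^k))`. -/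
def Triple.J (k : ℕ+) : T.V →ₗ[ℂ] T.V := T.shift (measurable_phaseJ k) (norm_phaseJ k) k

/-- `J_k' f(x) = (-1)^{x₁+⋯+x_k} c_k(x) (√(dμ(x+δ^k)/dμ(x)) f(x+δ^k))`. -/
def Triple.J' (k : ℕ+) : T.V →ₗ[ℂ] T.V := T.shift (measurable_phaseJ' k) (norm_phaseJ' k) k

/-! ### Invariant real forms -/

/-- A charge conjugation of `V(μ, ν, 𝒞)`: a `ℂ`-antilinear norm-preserving operator `S` with
`S² = 1` which commutes with the action of the Clifford algebra, i.e. with its generators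
`J_k` and `J_k'`. -/
structure Triple.IsChargeConjugation (S : T.V →ₗ⋆[ℂ] T.V) : Prop where
  comm_J : ∀ k f, S (T.J k f) = T.J k (S f)
  comm_J' : ∀ k f, S (T.J' k f) = T.J' k (S f)
  apply_apply : ∀ f, S (S f) = f
  norm_map : ∀ f, ‖S f‖ = ‖f‖

/-- An invariant real form of `V(μ, ν, 𝒞)`: the set of fixed vectors of a charge conjugation. -/
def Triple.IsInvariantRealForm (U : Set T.V) : Prop :=
  ∃ S : T.V →ₗ⋆[ℂ] T.V, T.IsChargeConjugation S ∧ U = {f | S f = f}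

/-- A measurable family of antilinear norm-preserving operators `r(x)` from `V_{x̌}` to `V_x` (which
are operators of `V_x` when `V_{x̌} = V_x`) with `r(x) r(x̌) = 1` and
`r(x) c_k(x̌) = (-1)^k c_k(x) r(x+δ^k)`, for all `k` and almost all `x`. Only the restriction of
`r(x)` to `V_{x̌}` matters; it is the restriction of a bounded antilinear operator of `K`. -/
structure Triple.IsConjugationField (r : X → K →L⋆[ℂ] K) : Prop where
  measurable : ∀ v : K, StronglyMeasurable fun x => r x v
  mapsTo : ∀ᵐ x ∂T.μ, ∀ v ∈ T.fiber (flipSeq x), r x v ∈ T.fiber x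
  norm_map : ∀ᵐ x ∂T.μ, ∀ v ∈ T.fiber (flipSeq x), ‖r x v‖ = ‖v‖
  apply_apply : ∀ᵐ x ∂T.μ, ∀ v ∈ T.fiber x, r x (r (flipSeq x) v) = v
  apply_c : ∀ k : ℕ+, ∀ᵐ x ∂T.μ, ∀ v ∈ T.fiber (flipSeq x + delta k),
    r x (T.c k (flipSeq x) v) = (-1 : ℂ) ^ (k : ℕ) • T.c k x (r (x + delta k) v)

end

end GardingWightman

end

noncomputable section

namespace GardingWightman

/-! The product `J' k ∘ J k` is multiplication by `-i (-1)^{x_k}`: translating twice by `δ^k` does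
nothing, the densities cancel and `c_k(x) c_k(x)^* = 1` on `V_x`. A charge conjugation `S` commutes
with this product but turns `i` into `-i`, so it anticommutes with multiplication by `(-1)^{x_k}`,
that is, it exchanges the indicators of `x_k = 0` and `x_k = 1`. Coordinates generate the
`σ`-algebra, hence `S` exchanges the indicators of `A` and `Ǎ` for every measurable `A`
(`IsChargeConjugation.flipsIndicator`).

Two consequences carry the direct implication. As almost all `V_x` are nonzero, the flip preserves
null sets. And `S` composed with the isometry `f ↦ √(dμ̌/dμ) f(x̌)` commutes with all indicators, so
it acts pointwise (`CommutesWithIndicators.exists_field`); this gives `(S f)(x) = √(dμ̌/dμ) r(x)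
f(x̌)` with antilinear contractions `r(x)`. The identities for `S` then become identities for `r(x)`
at almost every point, by testing on countably many elements of `V` (`ae_forall_mem_fiber`). The
sign `(-1)^k` is the effect of the flip and of complex conjugation on the phases. The dimensions
agree because `r(x)` is bijective with inverse `r(x̌)`.

Conversely, the same formula defines `S` from `r`; the chain rule for densities and the phase
identity give commutation with `J k` and `J' k` (`conj_shift`). -/

lemma stronglyMeasurable_field_apply {α E : Type*} [MeasurableSpace α] [NormedAddCommGroup E]
    {F : Type*} [TopologicalSpace F]
    [TopologicalSpace.PseudoMetrizableSpace F] [SecondCountableTopology E] {r : α → E → F}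
    (hc : ∀ x, Continuous (r x)) (hr : ∀ v, StronglyMeasurable fun x => r x v) {g : α → E}
    (hg : StronglyMeasurable g) : StronglyMeasurable fun x => r x (g x) := by
  borelize E
  have h := stronglyMeasurable_uncurry_of_continuous_of_stronglyMeasurable
    (u := fun (v : E) (x : α) => r x v) hc hr
  exact h.comp_measurable (hg.measurable.prodMk measurable_id)

/-! ### Antilinear contractions of `L²` commuting with indicators act pointwise -/

section Decomposable

open Filter Set

variable {α E : Type*} [MeasurableSpace α] {μ : Measure α}
  [NormedAddCommGroup E] [NormedSpace ℂ E]

/-- The square of the norm of an element of `L²`. -/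
lemma enorm_sq_eq_lintegral {F : Type*} [NormedAddCommGroup F] {f : Lp F 2 μ} {g : α → F}
    (hfg : f =ᵐ[μ] g) : ‖f‖ₑ ^ 2 = ∫⁻ x, ‖g x‖ₑ ^ 2 ∂μ := by
  have h := eLpNorm_nnreal_pow_eq_lintegral (f := g) (μ := μ) (p := 2) (by simp)
  rw [Lp.enorm_def, eLpNorm_congr_ae hfg]
  simpa using h

/-- An operator on `L²` that commutes with the
multiplication by the indicators of all measurable sets. -/
def CommutesWithIndicators (R : Lp E 2 μ →ₗ⋆[ℂ] Lp E 2 μ) : Prop :=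
  ∀ A : Set α, MeasurableSet A → ∀ f g : Lp E 2 μ, g =ᵐ[μ] A.indicator f →
    R g =ᵐ[μ] A.indicator (R f)

variable [SigmaFinite μ] (R : Lp E 2 μ →ₗ⋆[ℂ] Lp E 2 μ)

/-- The constant function `v` on the `n`-th spanning set. -/
def spanningConst (μ : Measure α) [SigmaFinite μ] (n : ℕ) (v : E) : Lp E 2 μ :=
  indicatorConstLp 2 (measurableSet_spanningSets μ n) (measure_spanningSets_lt_top μ n).ne v

/-- The value at `x` of the image of the function which is constant `v` near `x`. -/
def constImage (v : E) : α → E := fun x =>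
  (R (spanningConst μ (spanningSetsIndex μ x) v) : Lp E 2 μ) x

lemma stronglyMeasurable_constImage [SecondCountableTopology E] (v : E) :
    StronglyMeasurable (constImage R v) := by
  borelize E
  have h : Measurable fun p : ℕ × α => (R (spanningConst μ p.1 v) : Lp E 2 μ) p.2 :=
    measurable_from_prod_countable_right fun n =>
      (Lp.stronglyMeasurable (R (spanningConst μ n v))).measurable
  have hN : Measurable fun x => (spanningSetsIndex μ x, x) :=
    (measurableSet_spanningSetsIndex μ).prodMk measurable_id
  have h2 := h.comp hN
  exact h2.stronglyMeasurable

lemma constImage_add (v w : E) :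
    constImage R (v + w) =ᵐ[μ] fun x => constImage R v x + constImage R w x := by
  have h : ∀ n, R (spanningConst μ n (v + w)) =ᵐ[μ]
      fun x => R (spanningConst μ n v) x + R (spanningConst μ n w) x := fun n => by
    have : spanningConst μ n (v + w) = spanningConst μ n v + spanningConst μ n w :=
      indicatorConstLp_add.symm
    rw [this, map_add]
    exact Lp.coeFn_add _ _
  filter_upwards [ae_all_iff.2 h] with x hx using hx _

lemma constImage_smul (a : ℂ) (v : E) :
    constImage R (a • v) =ᵐ[μ] fun x => (starRingEnd ℂ) a • constImage R v x := by
  have h : ∀ n, R (spanningConst μ n (a • v)) =ᵐ[μ]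
      fun x => (starRingEnd ℂ) a • R (spanningConst μ n v) x := fun n => by
    have : spanningConst μ n (a • v) = a • spanningConst μ n v := by
      rw [spanningConst, spanningConst, indicatorConstLp, indicatorConstLp,
        ← MemLp.toLp_const_smul, MemLp.toLp_eq_toLp_iff]
      exact Eventually.of_forall fun x => by
        by_cases hx : x ∈ spanningSets μ n <;> simp [hx]
    rw [this, map_smulₛₗ]
    exact Lp.coeFn_smul _ _
  filter_upwards [ae_all_iff.2 h] with x hx using hx _

lemma constImage_sum {ι : Type*} (s : Finset ι) (a : ι → ℂ) (v : ι → E) :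
    constImage R (∑ i ∈ s, a i • v i) =ᵐ[μ]
      fun x => ∑ i ∈ s, (starRingEnd ℂ) (a i) • constImage R (v i) x := by
  classical
  induction s using Finset.induction_on with
  | empty =>
    have := constImage_smul R 0 (0 : E)
    simpa using this
  | insert i s hi ih =>
    simp only [Finset.sum_insert hi]
    filter_upwards [ih, constImage_add R (a i • v i) (∑ j ∈ s, a j • v j),
      constImage_smul R (a i) (v i)] with x h1 h2 h3
    rw [h2, h1, h3]

variable {R}

/-- On the `n`-th spanning set `Sₙ` both sides are the image of the function equal to `v` on `Sₙ ∩
s` and `0` elsewhere: it is a truncation of the constant on `s` and also of the constant on `Sₙ`. -/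
lemma CommutesWithIndicators.apply_indicatorConstLp (hR : CommutesWithIndicators R) {s : Set α}
    (hs : MeasurableSet s) (hμs : μ s ≠ ∞) (v : E) :
    R (indicatorConstLp 2 hs hμs v) =ᵐ[μ] s.indicator (constImage R v) := by
  have h : ∀ n, (spanningSets μ n).indicator (R (indicatorConstLp 2 hs hμs v)) =ᵐ[μ]
      s.indicator (R (spanningConst μ n v)) := fun n => by
    have hn := measurableSet_spanningSets μ n
    have hsn : μ (spanningSets μ n ∩ s) ≠ ∞ :=
      ((measure_mono inter_subset_right).trans_lt hμs.lt_top).ne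
    refine (hR _ hn _ (indicatorConstLp 2 (hn.inter hs) hsn v) ?_).symm.trans (hR _ hs _ _ ?_)
    · filter_upwards [indicatorConstLp_coeFn (p := 2) (hs := hn.inter hs) (hμs := hsn) (c := v),
        indicatorConstLp_coeFn (p := 2) (hs := hs) (hμs := hμs) (c := v)] with x h1 h2
      by_cases hx : x ∈ spanningSets μ n <;> by_cases hx' : x ∈ s <;> simp [h1, h2, hx, hx']
    · filter_upwards [indicatorConstLp_coeFn (p := 2) (hs := hn.inter hs) (hμs := hsn) (c := v),
        indicatorConstLp_coeFn (p := 2) (hs := hn)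
          (hμs := (measure_spanningSets_lt_top μ n).ne) (c := v)] with x h1 h2
      by_cases hx : x ∈ spanningSets μ n <;> by_cases hx' : x ∈ s <;>
        simp [spanningConst, h1, h2, hx, hx']
  filter_upwards [ae_all_iff.2 h] with x hx
  have := hx (spanningSetsIndex μ x)
  rw [indicator_of_mem (mem_spanningSetsIndex μ x)] at this
  rw [this]
  rfl

/-- Contractivity on the indicators of sets `s` of finite measure bounds the integral of
`‖constImage R v‖²` over `s` by that of `‖v‖²`; as `s` is arbitrary, the integrands compare. -/
lemma CommutesWithIndicators.norm_constImage_le [SecondCountableTopology E]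
    (hR : CommutesWithIndicators R) (hR1 : ∀ f, ‖R f‖ ≤ ‖f‖) (v : E) :
    ∀ᵐ x ∂μ, ‖constImage R v x‖ ≤ ‖v‖ := by
  have h : (fun x => ‖constImage R v x‖ₑ ^ 2) ≤ᵐ[μ] fun _ => ‖v‖ₑ ^ 2 := by
    refine ae_le_of_forall_setLIntegral_le_of_sigmaFinite
      ((stronglyMeasurable_constImage R v).enorm.pow_const 2) fun s hs hμs => ?_
    have h0 (w : α → E) : ∫⁻ x in s, ‖w x‖ₑ ^ 2 ∂μ = ∫⁻ x, ‖s.indicator w x‖ₑ ^ 2 ∂μ := by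
      rw [← lintegral_indicator hs]
      refine lintegral_congr fun x => ?_
      by_cases hx : x ∈ s <;> simp [hx]
    rw [h0, h0 fun _ => v, ← enorm_sq_eq_lintegral (hR.apply_indicatorConstLp hs hμs.ne v),
      ← enorm_sq_eq_lintegral
        (indicatorConstLp_coeFn (p := 2) (hs := hs) (hμs := hμs.ne) (c := v))]
    gcongr
    exact enorm_le_iff_norm_le.2 (hR1 _)
  filter_upwards [h] with x hx
  rw [← enorm_le_iff_norm_le]
  exact (ENNReal.pow_le_pow_left_iff two_ne_zero).1 hx

/-- A single null set must serve all coefficients. Countably many coefficient vectors, dense in each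
`ℂⁿ`, are handled almost everywhere, and continuity gives the others. -/
lemma CommutesWithIndicators.norm_sum_constImage_le [SecondCountableTopology E]
    (hR : CommutesWithIndicators R) (hR1 : ∀ f, ‖R f‖ ≤ ‖f‖) (e : ℕ → E) :
    ∀ᵐ x ∂μ, ∀ a : ℕ →₀ ℂ, ‖∑ i ∈ a.support, (starRingEnd ℂ) (a i) • constImage R (e i) x‖ ≤
      ‖∑ i ∈ a.support, a i • e i‖ := by
  have h : ∀ᵐ x ∂μ, ∀ n : ℕ, ∀ m : ℕ,
      ‖∑ i, (starRingEnd ℂ) (TopologicalSpace.denseSeq (Fin n → ℂ) m i) •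
        constImage R (e i) x‖ ≤ ‖∑ i, TopologicalSpace.denseSeq (Fin n → ℂ) m i • e i‖ := by
    refine ae_all_iff.2 fun n => ae_all_iff.2 fun m => ?_
    filter_upwards [hR.norm_constImage_le hR1
      (∑ i : Fin n, TopologicalSpace.denseSeq (Fin n → ℂ) m i • e i),
      constImage_sum R Finset.univ (TopologicalSpace.denseSeq (Fin n → ℂ) m)
        fun i : Fin n => e i] with x h1 h2
    rwa [← h2]
  filter_upwards [h] with x hx a
  obtain ⟨n, hn⟩ : ∃ n, a.support ⊆ Finset.range n := ⟨_, a.support.subset_range_sup_succ⟩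
  have key : ∀ b : Fin n → ℂ, ‖∑ i, (starRingEnd ℂ) (b i) • constImage R (e i) x‖ ≤
      ‖∑ i, b i • e i‖ := fun b => by
    refine (TopologicalSpace.denseRange_denseSeq (Fin n → ℂ)).induction_on b
      (isClosed_le ?_ ?_) (hx n)
    · have := Complex.continuous_conj
      fun_prop
    · fun_prop
  have := key fun i => a i
  rw [Fin.sum_univ_eq_sum_range (fun i => (starRingEnd ℂ) (a i) • constImage R (e i) x) n,
    Fin.sum_univ_eq_sum_range (fun i => a i • e i) n] at this
  rwa [Finset.sum_subset hn fun i _ hi => by simp [Finsupp.notMem_support_iff.1 hi],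
    Finset.sum_subset hn fun i _ hi => by simp [Finsupp.notMem_support_iff.1 hi]]

/-- A contraction of `L²` that commutes with the multiplication by the indicators of all measurable
sets acts pointwise. -/
theorem CommutesWithIndicators.exists_field [SecondCountableTopology E] [CompleteSpace E]
    (hR : CommutesWithIndicators R) (hR1 : ∀ f, ‖R f‖ ≤ ‖f‖) :
    ∃ r : α → E →L⋆[ℂ] E, (∀ v, StronglyMeasurable fun x => r x v) ∧ (∀ x v, ‖r x v‖ ≤ ‖v‖) ∧
      ∀ f : Lp E 2 μ, R f =ᵐ[μ] fun x => r x (f x) := by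
  classical
  let e : ℕ → E := TopologicalSpace.denseSeq E
  have he : DenseRange e := TopologicalSpace.denseRange_denseSeq E
  let ε : (ℕ →₀ ℂ) →ₗ[ℂ] E := Finsupp.linearCombination ℂ e
  have hεs (n : ℕ) : ε (Finsupp.single n 1) = e n := by simp [ε]
  have hε : DenseRange ε := Dense.mono
    (by rintro v ⟨n, rfl⟩; exact ⟨Finsupp.single n 1, hεs n⟩) he
  let κ (x : α) : (ℕ →₀ ℂ) →ₗ⋆[ℂ] E :=
    { toFun := fun a => a.sum fun i z => (starRingEnd ℂ) z • constImage R (e i) x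
      map_add' := fun a b => Finsupp.sum_add_index' (by simp) (by simp [add_smul])
      map_smul' := fun z a => by
        rw [Finsupp.sum_smul_index (by simp), Finsupp.smul_sum]
        simp [mul_smul] }
  have hκs (x : α) (n : ℕ) : κ x (Finsupp.single n 1) = constImage R (e n) x := by simp [κ]
  obtain ⟨G, hGm, hG0, hG⟩ : ∃ G : Set α, MeasurableSet G ∧ (∀ᵐ x ∂μ, x ∈ G) ∧
      ∀ x ∈ G, ∀ a, ‖κ x a‖ ≤ 1 * ‖ε a‖ := by
    obtain ⟨G, hG, hGm, hG0⟩ := (hR.norm_sum_constImage_le hR1 e).exists_measurable_mem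
    refine ⟨G, hGm, hG, fun x hx a => ?_⟩
    rw [one_mul]
    exact hG0 x hx a
  -- On `G` the bound `hG` makes `κ x` factor through `ε`, whose range is dense, so it extends to
  -- `E`. The value `0` elsewhere keeps `r x` a contraction at every point.
  let r (x : α) : E →L⋆[ℂ] E := if x ∈ G then (κ x).extendOfNorm ε else 0
  have hre (x : α) (hx : x ∈ G) (n : ℕ) : r x (e n) = constImage R (e n) x := by
    simp only [r, hx, if_true]
    rw [← hκs, ← hεs, LinearMap.extendOfNorm_eq hε ⟨1, hG x hx⟩]
  have hr1 (x : α) (v : E) : ‖r x v‖ ≤ ‖v‖ := by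
    by_cases hx : x ∈ G
    · simp only [r, hx, if_true]
      simpa using LinearMap.norm_extendOfNorm_apply_le hε 1 (hG x hx) v
    · simp [r, hx]
  have hrm (v : E) : StronglyMeasurable fun x => r x v := by
    obtain ⟨u, hu, huv⟩ := mem_closure_iff_seq_limit.1 (he v)
    choose i hi using hu
    refine stronglyMeasurable_of_tendsto atTop (f := fun n x => r x (u n)) (fun n => ?_)
      (tendsto_pi_nhds.2 fun x => ((r x).continuous.tendsto v).comp huv)
    have : (fun x => r x (u n)) = G.indicator (constImage R (e (i n))) := by
      funext x
      rw [← hi]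
      by_cases hx : x ∈ G
      · rw [hre x hx, indicator_of_mem hx]
      · simp [r, hx]
    rw [this]
    exact (stronglyMeasurable_constImage R _).indicator hGm
  have hrq (v : E) : ∀ᵐ x ∂μ, constImage R v x = r x v := by
    have h (n : ℕ) : ∀ᵐ x ∂μ, ‖constImage R v x - constImage R (e n) x‖ ≤ ‖v - e n‖ := by
      filter_upwards [constImage_add R (v - e n) (e n), hR.norm_constImage_le hR1 (v - e n)]
        with x h1 h2
      rw [sub_add_cancel] at h1
      rwa [h1, add_sub_cancel_right]
    filter_upwards [ae_all_iff.2 h, hG0] with x hx hxG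
    rw [← sub_eq_zero, ← norm_le_zero_iff]
    -- The bound by `2 * ‖v - w‖` is closed in `w` and holds on the dense sequence; `w = v` gives
    -- equality.
    refine he.induction_on (p := fun w => ‖constImage R v x - r x v‖ ≤ 2 * ‖v - w‖) v ?_ ?_
      |>.trans (by simp)
    · exact isClosed_le continuous_const (by fun_prop)
    · intro n
      calc ‖constImage R v x - r x v‖
          = ‖(constImage R v x - constImage R (e n) x) - r x (v - e n)‖ := by
            rw [map_sub, hre x hxG]; congr 1; abel
        _ ≤ ‖v - e n‖ + ‖v - e n‖ := (norm_sub_le _ _).trans (add_le_add (hx n) (hr1 x _))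
        _ = 2 * ‖v - e n‖ := by ring
  have hmem (f : Lp E 2 μ) : MemLp (fun x => r x (f x)) 2 μ :=
    (Lp.memLp f).mono (stronglyMeasurable_field_apply (fun x => (r x).continuous) hrm
      (Lp.stronglyMeasurable f)).aestronglyMeasurable (Eventually.of_forall fun x => hr1 x _)
  refine ⟨r, hrm, hr1, fun f => ?_⟩
  refine Lp.induction (by simp) (fun f => R f =ᵐ[μ] fun x => r x (f x)) ?_ ?_ ?_ f
  · intro v s hs hμs
    rw [Lp.simpleFunc.coe_indicatorConst]
    filter_upwards [hR.apply_indicatorConstLp hs hμs.ne v, hrq v,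
      indicatorConstLp_coeFn (p := 2) (hs := hs) (hμs := hμs.ne) (c := v)] with x h1 h2 h3
    rw [h1, h3]
    by_cases hx : x ∈ s <;> simp [hx, h2]
  · intro f g hf hg _ h1 h2
    rw [map_add]
    filter_upwards [h1, h2, Lp.coeFn_add (R hf.toLp) (R hg.toLp), Lp.coeFn_add hf.toLp hg.toLp]
      with x h1 h2 h3 h4
    rw [h3, h4, Pi.add_apply, Pi.add_apply, h1, h2, map_add]
  · have hRc : Continuous R := (R.mkContinuous 1 (by simpa using hR1)).continuous
    have hNc : Continuous fun f : Lp E 2 μ => (hmem f).toLp := by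
      refine (LipschitzWith.of_dist_le_mul (K := 1) fun f g => ?_).continuous
      rw [dist_eq_norm, dist_eq_norm, NNReal.coe_one, one_mul]
      refine Lp.norm_le_norm_of_ae_le ?_
      filter_upwards [(hmem f).coeFn_toLp, (hmem g).coeFn_toLp,
        Lp.coeFn_sub (hmem f).toLp (hmem g).toLp, Lp.coeFn_sub f g] with x h1 h2 h3 h4
      rw [h3, h4, Pi.sub_apply, Pi.sub_apply, h1, h2, ← map_sub]
      exact hr1 x _
    convert isClosed_eq hRc hNc using 3 with f
    rw [Lp.ext_iff]
    exact ⟨fun h => h.trans (hmem f).coeFn_toLp.symm, fun h => h.trans (hmem f).coeFn_toLp⟩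

end Decomposable

/-! ### Translations of `X` as isometries of `L²` -/

section WeightedTranslation

lemma add_add_self (x d : X) : x + d + d = x := by
  funext j
  simp [add_assoc, CharTwo.add_self_eq_zero]

lemma measurable_add_right (d : X) : Measurable fun x : X => x + d :=
  measurable_id.add_const _

lemma translate_translate (d e : X) (μ : Measure X) :
    translate d (translate e μ) = translate (d + e) μ := by
  rw [translate, translate, translate,
    Measure.map_map (measurable_add_right d) (measurable_add_right e)]
  congr 1
  funext x
  simp [add_assoc, add_comm e d]

lemma add_self_eq_zero (d : X) : d + d = 0 := by
  simpa using add_add_self 0 d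

lemma translate_zero (μ : Measure X) : translate 0 μ = μ := by
  simp [translate]

/-- Translation by `d` is an involution, so translating the hypothesis reverses it. -/
lemma absolutelyContinuous_translate {d : X} {μ : Measure X} (h : translate d μ ≪ μ) :
    μ ≪ translate d μ := by
  have h1 : translate d (translate d μ) ≪ translate d μ := h.map (measurable_add_right d)
  rwa [translate_translate, add_self_eq_zero, translate_zero] at h1

lemma translate_add_absolutelyContinuous {d e : X} {μ : Measure X} (hd : translate d μ ≪ μ)
    (he : translate e μ ≪ μ) : translate (d + e) μ ≪ μ := by
  rw [← translate_translate]
  exact (he.map (measurable_add_right d)).trans hd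

lemma quasiMeasurePreserving_add {d : X} {μ : Measure X} (h : translate d μ ≪ μ) :
    Measure.QuasiMeasurePreserving (fun x : X => x + d) μ μ :=
  ⟨measurable_add_right d, h⟩

variable (μ : Measure X)

/-- `√(dμ(x+d)/dμ(x))`. -/
def weight (d : X) (x : X) : ℝ := √((translate d μ).rnDeriv μ x).toReal

lemma measurable_weight (d : X) : Measurable (weight μ d) :=
  (Measure.measurable_rnDeriv _ _).ennreal_toReal.sqrt

lemma weight_nonneg (d x : X) : 0 ≤ weight μ d x := Real.sqrt_nonneg _

variable {μ}

lemma weight_zero [SigmaFinite μ] : ∀ᵐ x ∂μ, weight μ 0 x = 1 := by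
  filter_upwards [Measure.rnDeriv_self μ] with x hx
  simp [weight, translate_zero, hx]

/-- The chain rule for the Radon-Nikodym derivatives of the translates. -/
lemma weight_mul_weight [SigmaFinite μ] {d e : X} (hd : translate d μ ≪ μ) (he : translate e μ ≪ μ) :
    ∀ᵐ x ∂μ, weight μ d x * weight μ e (x + d) = weight μ (d + e) x := by
  have h1 := Measure.rnDeriv_mul_rnDeriv (κ := μ)
    (show translate d (translate e μ) ≪ translate d μ from he.map (measurable_add_right d))
  -- The density of two measures both translated by `d` is the original density at `x + d`.
  have h2 := (quasiMeasurePreserving_add hd).ae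
    ((MeasurableEquiv.addRight d).measurableEmbedding.rnDeriv_map (translate e μ) μ)
  filter_upwards [h1, h2] with x h1 h2
  simp only [MeasurableEquiv.coe_addRight, add_add_self] at h2
  rw [translate_translate] at h1
  rw [weight, weight, weight, ← Real.sqrt_mul ENNReal.toReal_nonneg, ← ENNReal.toReal_mul, ← h2,
    ← h1, Pi.mul_apply, mul_comm, ← translate_translate]
  rfl

lemma weight_mul_self [SigmaFinite μ] {d : X} (hd : translate d μ ≪ μ) :
    ∀ᵐ x ∂μ, weight μ d x * weight μ d (x + d) = 1 := by
  filter_upwards [weight_mul_weight hd hd, weight_zero (μ := μ)] with x h1 h2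
  rw [h1, add_self_eq_zero, h2]

variable {K : Type*} [NormedAddCommGroup K] [NormedSpace ℂ K]

/-- The function `x ↦ √(dμ(x+d)/dμ(x)) f(x+d)`. -/
def weightedTranslateFun (μ : Measure X) (d : X) (f : X → K) (x : X) : K :=
  (weight μ d x : ℂ) • f (x + d)

lemma stronglyMeasurable_weightedTranslateFun (d : X) {f : X → K} (hf : StronglyMeasurable f) :
    StronglyMeasurable (weightedTranslateFun μ d f) :=
  (Complex.measurable_ofReal.comp (measurable_weight μ d)).stronglyMeasurable.smul
    (hf.comp_measurable (measurable_add_right d))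

lemma weightedTranslateFun_congr {d : X} (hd : translate d μ ≪ μ) {f g : X → K} (h : f =ᵐ[μ] g) :
    weightedTranslateFun μ d f =ᵐ[μ] weightedTranslateFun μ d g := by
  filter_upwards [(quasiMeasurePreserving_add hd).ae h] with x hx
  rw [weightedTranslateFun, weightedTranslateFun, hx]

variable [SigmaFinite μ]

lemma eLpNorm_weightedTranslateFun {d : X} (hd : translate d μ ≪ μ) {f : X → K}
    (hf : StronglyMeasurable f) :
    eLpNorm (weightedTranslateFun μ d f) 2 μ = eLpNorm f 2 μ := by
  have h2 (g : X → K) := eLpNorm_nnreal_pow_eq_lintegral (f := g) (μ := μ) (p := 2) (by simp)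
  have h3 : ∫⁻ x, ‖weightedTranslateFun μ d f x‖ₑ ^ 2 ∂μ = ∫⁻ x, ‖f x‖ₑ ^ 2 ∂μ := by
    have hm : Measurable fun x => ‖f x‖ₑ ^ 2 := hf.enorm.pow_const 2
    calc ∫⁻ x, ‖weightedTranslateFun μ d f x‖ₑ ^ 2 ∂μ
        = ∫⁻ x, (translate d μ).rnDeriv μ x * ‖f (x + d)‖ₑ ^ 2 ∂μ := by
          refine lintegral_congr_ae ?_
          filter_upwards [Measure.rnDeriv_lt_top (translate d μ) μ] with x hx
          rw [weightedTranslateFun, enorm_smul, mul_pow, ← ofReal_norm (weight μ d x : ℂ),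
            Complex.norm_real, Real.norm_of_nonneg (weight_nonneg μ d x),
            ← ENNReal.ofReal_pow (weight_nonneg μ d x), weight,
            Real.sq_sqrt ENNReal.toReal_nonneg, ENNReal.ofReal_toReal hx.ne]
      _ = ∫⁻ x, ‖f (x + d)‖ₑ ^ 2 ∂(translate d μ) :=
          lintegral_rnDeriv_mul hd (hm.comp (measurable_add_right d)).aemeasurable
      _ = ∫⁻ x, ‖f x‖ₑ ^ 2 ∂μ := by
          rw [translate, lintegral_map (f := fun x => ‖f (x + d)‖ₑ ^ 2)
            (hm.comp (measurable_add_right d)) (measurable_add_right d)]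
          simp only [add_add_self]
  have h4 : eLpNorm (weightedTranslateFun μ d f) 2 μ ^ 2 = eLpNorm f 2 μ ^ 2 := by
    simpa [h3] using (h2 (weightedTranslateFun μ d f)).trans
      (by simpa using h3.trans (by simpa using (h2 f).symm))
  exact (ENNReal.pow_right_strictMono two_ne_zero).injective h4

lemma memLp_weightedTranslateFun {d : X} (hd : translate d μ ≪ μ) (f : Lp K 2 μ) :
    MemLp (weightedTranslateFun μ d f) 2 μ :=
  ⟨(stronglyMeasurable_weightedTranslateFun d (Lp.stronglyMeasurable f)).aestronglyMeasurable, by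
    rw [eLpNorm_weightedTranslateFun hd (Lp.stronglyMeasurable f)]
    exact Lp.eLpNorm_lt_top f⟩

/-- The isometry `f ↦ (x ↦ √(dμ(x+d)/dμ(x)) f(x+d))` of `L²(X, μ; K)`. -/
def weightedTranslate {d : X} (hd : translate d μ ≪ μ) : Lp K 2 μ →ₗᵢ[ℂ] Lp K 2 μ where
  toFun f := (memLp_weightedTranslateFun hd f).toLp
  map_add' f g := by
    rw [← MemLp.toLp_add, MemLp.toLp_eq_toLp_iff]
    refine (weightedTranslateFun_congr hd (Lp.coeFn_add f g)).trans (.of_eq ?_)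
    funext x
    simp [weightedTranslateFun]
  map_smul' a f := by
    rw [RingHom.id_apply, ← MemLp.toLp_const_smul, MemLp.toLp_eq_toLp_iff]
    refine (weightedTranslateFun_congr hd (Lp.coeFn_smul a f)).trans (.of_eq ?_)
    funext x
    simp [weightedTranslateFun, smul_comm a]
  norm_map' f := by
    change ‖(memLp_weightedTranslateFun hd f).toLp‖ = ‖f‖
    rw [Lp.norm_toLp, eLpNorm_weightedTranslateFun hd (Lp.stronglyMeasurable f), Lp.norm_def]

lemma coeFn_weightedTranslate {d : X} (hd : translate d μ ≪ μ) (f : Lp K 2 μ) :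
    weightedTranslate hd f =ᵐ[μ] weightedTranslateFun μ d f :=
  (memLp_weightedTranslateFun hd f).coeFn_toLp

lemma weightedTranslate_self_apply {d : X} (hd : translate d μ ≪ μ) (f : Lp K 2 μ) :
    weightedTranslate hd (weightedTranslate hd f) = f := by
  rw [Lp.ext_iff]
  refine (coeFn_weightedTranslate hd _).trans
    ((weightedTranslateFun_congr hd (coeFn_weightedTranslate hd f)).trans ?_)
  filter_upwards [weight_mul_self hd] with x hx
  rw [weightedTranslateFun, weightedTranslateFun, smul_smul, ← Complex.ofReal_mul, hx,
    add_add_self, Complex.ofReal_one, one_smul]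

end WeightedTranslation

/-! ### Truncations and pointwise tests in the direct integral -/

section DirectIntegral

section

open Filter Topology Set

/-- The truncations of an `L²` function to an increasing sequence of sets converge to the truncation
to the union. -/
lemma tendsto_of_ae_eq_indicator {α E : Type*} [MeasurableSpace α] {μ : Measure α}
    [NormedAddCommGroup E] {B : ℕ → Set α} (hB : Monotone B) {f g : Lp E 2 μ} {u : ℕ → Lp E 2 μ}
    (hu : ∀ n, u n =ᵐ[μ] (B n).indicator f) (hg : g =ᵐ[μ] (⋃ n, B n).indicator f) :
    Tendsto u atTop (𝓝 g) := by
  rw [tendsto_iff_edist_tendsto_0]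
  have hae (n : ℕ) : ∀ᵐ x ∂μ, (u n - g : Lp E 2 μ) x =
      (B n).indicator f x - (⋃ n, B n).indicator f x := by
    filter_upwards [Lp.coeFn_sub (u n) g, hu n, hg] with x h1 h2 h3
    rw [h1, Pi.sub_apply, h2, h3]
  -- Dominated convergence, with `‖f‖²` as the dominating function.
  have hsq : Tendsto (fun n => ‖u n - g‖ₑ ^ 2) atTop (𝓝 0) := by
    have hlim : Tendsto (fun n => ∫⁻ x, ‖(u n - g : Lp E 2 μ) x‖ₑ ^ 2 ∂μ) atTop
        (𝓝 (∫⁻ _, 0 ∂μ)) := by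
      refine tendsto_lintegral_of_dominated_convergence (fun x => ‖f x‖ₑ ^ 2)
        (fun n => (Lp.stronglyMeasurable _).enorm.pow_const 2) (fun n => ?_) ?_ ?_
      · filter_upwards [hae n] with x hx
        rw [hx]
        gcongr
        by_cases h1 : x ∈ B n
        · simp [h1, mem_iUnion_of_mem n h1]
        · by_cases h2 : x ∈ ⋃ n, B n <;> simp [h1, h2]
      · rw [← enorm_sq_eq_lintegral (ae_eq_refl f)]
        exact (ENNReal.pow_lt_top enorm_lt_top).ne
      · filter_upwards [ae_all_iff.2 hae] with x hx
        refine tendsto_const_nhds.congr' ?_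
        by_cases h2 : x ∈ ⋃ n, B n
        · obtain ⟨m, hm⟩ := mem_iUnion.1 h2
          filter_upwards [eventually_ge_atTop m] with n hn
          rw [hx, indicator_of_mem h2, indicator_of_mem (hB hn hm)]
          simp
        · refine Eventually.of_forall fun n => ?_
          simp only [hx, indicator_of_notMem h2,
            indicator_of_notMem fun h => h2 (mem_iUnion_of_mem n h)]
          simp
    simpa [enorm_sq_eq_lintegral (ae_eq_refl _)] using hlim
  have := ((ENNReal.continuous_rpow_const (y := 1 / 2)).tendsto 0).comp hsq
  simp only [edist_eq_enorm_sub]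
  refine (this.congr fun n => ?_).trans (by simp)
  rw [Function.comp_apply, ← ENNReal.rpow_natCast, ← ENNReal.rpow_mul]
  simp

end

variable {K : Type*} [NormedAddCommGroup K] [InnerProductSpace ℂ K] [CompleteSpace K]

namespace Triple

open Filter Set

variable (T : Triple K)

lemma ae_mem_fiber (f : T.V) : ∀ᵐ x ∂T.μ, (f : Lp K 2 T.μ) x ∈ T.fiber x := f.2

variable {T} in
lemma V_ext {f g : T.V} (h : (f : Lp K 2 T.μ) =ᵐ[T.μ] (g : Lp K 2 T.μ)) : f = g :=
  Subtype.ext (Lp.ext h)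

lemma starProjection_eq_self {W : ClosedSubmodule ℂ K} {v : K} (hv : v ∈ W) :
    W.starProjection v = v :=
  Submodule.starProjection_eq_self_iff.2 hv

lemma starProjection_mem (W : ClosedSubmodule ℂ K) (v : K) : W.starProjection v ∈ W :=
  Submodule.starProjection_apply_mem W.toSubmodule v

lemma memLp_indicator {A : Set X} (hA : MeasurableSet A) (f : T.V) :
    MemLp (A.indicator (f : Lp K 2 T.μ)) 2 T.μ :=
  (Lp.memLp (f : Lp K 2 T.μ)).indicator hA

lemma toLp_indicator_mem {A : Set X} (hA : MeasurableSet A) (f : T.V) :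
    (T.memLp_indicator hA f).toLp ∈ T.V := by
  change ∀ᵐ x ∂T.μ, _ ∈ T.fiber x
  filter_upwards [(T.memLp_indicator hA f).coeFn_toLp, T.ae_mem_fiber f] with x h1 h2
  rw [h1]
  by_cases hx : x ∈ A
  · rwa [indicator_of_mem hx]
  · rw [indicator_of_notMem hx]
    exact zero_mem (T.fiber x).toSubmodule

/-- The truncation of an element of `V` to a measurable set. -/
def cut {A : Set X} (hA : MeasurableSet A) (f : T.V) : T.V :=
  ⟨(T.memLp_indicator hA f).toLp, T.toLp_indicator_mem hA f⟩

lemma coe_cut {A : Set X} (hA : MeasurableSet A) (f : T.V) :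
    (T.cut hA f : Lp K 2 T.μ) =ᵐ[T.μ] A.indicator (f : Lp K 2 T.μ) :=
  (T.memLp_indicator hA f).coeFn_toLp

section Projection

variable [SecondCountableTopology K]

lemma memLp_starProjection (f : Lp K 2 T.μ) :
    MemLp (fun x => (T.fiber x).starProjection (f x)) 2 T.μ :=
  (Lp.memLp f).mono (stronglyMeasurable_field_apply
    (r := fun x => (T.fiber x).starProjection) (fun x => (T.fiber x).starProjection.continuous)
    T.measurable_fiber (Lp.stronglyMeasurable f)).aestronglyMeasurable
    (Eventually.of_forall fun _ => Submodule.norm_starProjection_apply_le _ _)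

/-- The orthogonal projection of `L²(X, μ; K)` onto `V(μ, ν, 𝒞)`. -/
def proj : Lp K 2 T.μ →ₗ[ℂ] T.V where
  toFun f := ⟨(T.memLp_starProjection f).toLp, by
    change ∀ᵐ x ∂T.μ, _ ∈ T.fiber x
    filter_upwards [(T.memLp_starProjection f).coeFn_toLp] with x hx
    rw [hx]
    exact starProjection_mem _ _⟩
  map_add' f g := by
    apply Subtype.ext
    change (T.memLp_starProjection (f + g)).toLp =
      (T.memLp_starProjection f).toLp + (T.memLp_starProjection g).toLp
    rw [← MemLp.toLp_add, MemLp.toLp_eq_toLp_iff]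
    filter_upwards [Lp.coeFn_add f g] with x hx
    rw [hx, Pi.add_apply, map_add, Pi.add_apply]
  map_smul' a f := by
    apply Subtype.ext
    change (T.memLp_starProjection (a • f)).toLp = a • (T.memLp_starProjection f).toLp
    rw [← MemLp.toLp_const_smul, MemLp.toLp_eq_toLp_iff]
    filter_upwards [Lp.coeFn_smul a f] with x hx
    rw [hx, Pi.smul_apply, map_smul, Pi.smul_apply]

lemma coe_proj (f : Lp K 2 T.μ) :
    (T.proj f : Lp K 2 T.μ) =ᵐ[T.μ] fun x => (T.fiber x).starProjection (f x) :=
  (T.memLp_starProjection f).coeFn_toLp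

lemma norm_proj_le (f : Lp K 2 T.μ) : ‖T.proj f‖ ≤ ‖f‖ := by
  refine Lp.norm_le_norm_of_ae_le (f := (T.proj f : Lp K 2 T.μ)) ?_
  filter_upwards [T.coe_proj f] with x hx
  rw [hx]
  exact Submodule.norm_starProjection_apply_le _ _

lemma proj_coe (f : T.V) : T.proj f = f := by
  refine V_ext ((T.coe_proj f).trans ?_)
  filter_upwards [T.ae_mem_fiber f] with x hx
  exact starProjection_eq_self hx

/-- A closed condition on the vectors of `V_{x+d}` that is satisfied by the values of all elements of
`V(μ, ν, 𝒞)` is satisfied by all vectors. -/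
lemma ae_forall_mem_fiber {d : X} (hd : translate d T.μ ≪ T.μ) {p : X → K → Prop}
    (hp : ∀ x, IsClosed {v | p x v})
    (h : ∀ f : T.V, ∀ᵐ x ∂T.μ, p x ((f : Lp K 2 T.μ) (x + d))) :
    ∀ᵐ x ∂T.μ, ∀ v ∈ T.fiber (x + d), p x v := by
  let e := TopologicalSpace.denseSeq K
  -- The test elements are the projections to `V` of the constants `e n` on the spanning sets. They
  -- are countable in number, and at almost every point their values include the projections of a
  -- dense sequence, which are dense in the fiber.
  have h1 : ∀ n i, ∀ᵐ x ∂T.μ, x + d ∈ spanningSets T.μ i →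
      p x ((T.fiber (x + d)).starProjection (e n)) := fun n i => by
    have h2 := (T.coe_proj (spanningConst T.μ i (e n)))
    have h3 : spanningConst T.μ i (e n) =ᵐ[T.μ] _ := indicatorConstLp_coeFn
    filter_upwards [h (T.proj (spanningConst T.μ i (e n))),
      (quasiMeasurePreserving_add hd).ae h2, (quasiMeasurePreserving_add hd).ae h3]
      with x hx h2 h3 hi
    rwa [h2, h3, indicator_of_mem hi] at hx
  filter_upwards [ae_all_iff.2 fun n => ae_all_iff.2 (h1 n)] with x hx v hv
  have key : ∀ w, p x ((T.fiber (x + d)).starProjection w) := fun w =>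
    (TopologicalSpace.denseRange_denseSeq K).induction_on w
      ((hp x).preimage (T.fiber (x + d)).starProjection.continuous)
      fun n => hx n _ (mem_spanningSetsIndex T.μ (x + d))
  have := key v
  rwa [starProjection_eq_self hv] at this

/-- If all elements of `V(μ, ν, 𝒞)` vanish almost everywhere on `A`, then `A` is a null set. -/
lemma measure_eq_zero_of_forall {A : Set X}
    (h : ∀ f : T.V, ∀ᵐ x ∂T.μ, x ∈ A → (f : Lp K 2 T.μ) x = 0) : T.μ A = 0 := by
  have h0 : translate 0 T.μ ≪ T.μ := by rw [translate_zero]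
  -- This forces `V_x = 0` at almost every `x ∈ A`, against `fiber_ne_bot`.
  have := T.ae_forall_mem_fiber h0 (p := fun x v => x ∈ A → v = 0)
    (fun x => by by_cases hx : x ∈ A <;> simp [hx]) (by simpa using h)
  refine measure_eq_zero_iff_ae_notMem.2 ?_
  filter_upwards [this, T.fiber_ne_bot] with x hx hb hxA
  rw [add_zero] at hx
  refine hb (SetLike.ext fun v => ⟨fun hv => ?_, fun hv => ?_⟩)
  · rw [hx v hv hxA]
    exact zero_mem (⊥ : ClosedSubmodule ℂ K).toSubmodule
  · have : v = 0 := by simpa using hv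
    rw [this]
    exact zero_mem (T.fiber x).toSubmodule

end Projection

end Triple

end DirectIntegral

/-! ### A charge conjugation exchanges the indicators of `A` and `Ǎ` -/

section Flip

lemma partialSum_eq (k : ℕ+) (x : X) : partialSum k x = partialSumBefore k x + (x k).val := by
  rw [partialSum, partialSumBefore, ← Finset.Iio_insert, Finset.sum_insert (by simp), add_comm]

lemma partialSumBefore_add_delta (k : ℕ+) (x : X) :
    partialSumBefore k (x + delta k) = partialSumBefore k x := by
  refine Finset.sum_congr rfl fun j hj => ?_
  simp [delta, (Finset.mem_Iio.1 hj).ne]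

/-- The sign `(-1)^{x_k}`. -/
def coordSign (k : ℕ+) (x : X) : ℂ := (-1) ^ (x k).val

lemma zmod_two_cases (a : ZMod 2) : a = 0 ∨ a = 1 := by
  revert a; decide

lemma coordSign_of_eq_zero {k : ℕ+} {x : X} (h : x k = 0) : coordSign k x = 1 := by
  simp [coordSign, h]

lemma coordSign_of_ne_zero {k : ℕ+} {x : X} (h : x k ≠ 0) : coordSign k x = -1 := by
  have : x k = 1 := (zmod_two_cases (x k)).resolve_left h
  simp [coordSign, this, ZMod.val_one]

/-- The coordinates before `k` contribute the same sign twice, so only `x_k` survives. -/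
lemma phaseJ'_mul_phaseJ (k : ℕ+) (x : X) :
    phaseJ' k x * phaseJ k (x + delta k) = -Complex.I * coordSign k x := by
  rw [phaseJ', phaseJ, partialSum_eq, partialSumBefore_add_delta, pow_add, coordSign]
  have : ((-1 : ℂ) ^ partialSumBefore k x) * (-1) ^ partialSumBefore k x = 1 := by
    rw [← mul_pow]; simp
  linear_combination (-Complex.I * (-1) ^ (x k).val) * this

lemma flipSeq_flipSeq (x : X) : flipSeq (flipSeq x) = x := add_add_self x 1

lemma measurable_flipSeq : Measurable flipSeq := measurable_add_right 1

variable {K : Type*} [NormedAddCommGroup K] [InnerProductSpace ℂ K] [CompleteSpace K]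

namespace Triple

open Filter Set Topology

variable {T : Triple K}

/-- `S` exchanges the multiplication by the indicator of `A` with the one by the indicator of `Ǎ`. -/
def FlipsIndicator (S : T.V →ₗ⋆[ℂ] T.V) (A : Set X) : Prop :=
  MeasurableSet A ∧ ∀ f g : T.V, (g : Lp K 2 T.μ) =ᵐ[T.μ] A.indicator (f : Lp K 2 T.μ) →
    (S g : Lp K 2 T.μ) =ᵐ[T.μ] (flipSeq ⁻¹' A).indicator (S f : Lp K 2 T.μ)

lemma FlipsIndicator.compl {S : T.V →ₗ⋆[ℂ] T.V} {A : Set X} (h : FlipsIndicator S A) :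
    FlipsIndicator S Aᶜ := by
  refine ⟨h.1.compl, fun f g hg => ?_⟩
  have hgf : g = f - T.cut h.1 f := by
    refine V_ext ?_
    filter_upwards [hg, T.coe_cut h.1 f, Lp.coeFn_sub (f : Lp K 2 T.μ) (T.cut h.1 f)]
      with x h1 h2 h3
    rw [Submodule.coe_sub, h3, Pi.sub_apply, h1, h2]
    by_cases hx : x ∈ A <;> simp [hx]
  rw [hgf, map_sub, Submodule.coe_sub]
  filter_upwards [Lp.coeFn_sub (S f : Lp K 2 T.μ) (S (T.cut h.1 f)), h.2 f _ (T.coe_cut h.1 f)]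
    with x h1 h2
  rw [h1, Pi.sub_apply, h2]
  by_cases hx : flipSeq x ∈ A
  · rw [indicator_of_mem (by exact hx), indicator_of_notMem (by simpa using hx), sub_self]
  · rw [indicator_of_notMem (by exact hx), indicator_of_mem (by simpa using hx), sub_zero]

lemma FlipsIndicator.inter {S : T.V →ₗ⋆[ℂ] T.V} {A B : Set X} (hA : FlipsIndicator S A)
    (hB : FlipsIndicator S B) : FlipsIndicator S (A ∩ B) := by
  refine ⟨hA.1.inter hB.1, fun f g hg => ?_⟩
  have h1 : (S g : Lp K 2 T.μ) =ᵐ[T.μ] _ := hA.2 (T.cut hB.1 f) g <| by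
    filter_upwards [hg, T.coe_cut hB.1 f] with x h1 h2
    rw [h1, ← indicator_indicator]
    by_cases hx : x ∈ A
    · rw [indicator_of_mem hx, indicator_of_mem hx, h2]
    · rw [indicator_of_notMem hx, indicator_of_notMem hx]
  filter_upwards [h1, hB.2 f _ (T.coe_cut hB.1 f)] with x h1 h2
  rw [h1, preimage_inter, ← indicator_indicator]
  by_cases hx : x ∈ flipSeq ⁻¹' A
  · rw [indicator_of_mem hx, indicator_of_mem hx, h2]
  · rw [indicator_of_notMem hx, indicator_of_notMem hx]

lemma FlipsIndicator.empty (S : T.V →ₗ⋆[ℂ] T.V) : FlipsIndicator S ∅ := by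
  refine ⟨.empty, fun f g hg => ?_⟩
  have h0 : g = 0 := V_ext (hg.trans (by
    rw [indicator_empty]
    exact (Lp.coeFn_zero K 2 T.μ).symm))
  rw [h0, map_zero, preimage_empty, indicator_empty]
  exact Lp.coeFn_zero K 2 T.μ

/-- Finite unions reduce to complements and intersections. For the increasing union, truncations
converge in `L²` and `S`, being isometric, is continuous. -/
lemma FlipsIndicator.iUnion {S : T.V →ₗ⋆[ℂ] T.V} (hS : ∀ f, ‖S f‖ = ‖f‖) {A : ℕ → Set X}
    (hA : ∀ n, FlipsIndicator S (A n)) : FlipsIndicator S (⋃ n, A n) := by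
  have hB (n : ℕ) : FlipsIndicator S (partialSups A n) := by
    induction n with
    | zero => simpa using hA 0
    | succ n ih =>
      have : partialSups A (n + 1) = ((partialSups A n)ᶜ ∩ (A (n + 1))ᶜ)ᶜ := by
        rw [← Order.succ_eq_add_one, partialSups_succ, compl_inter, compl_compl, compl_compl]
        rfl
      rw [this]
      exact (ih.compl.inter (hA _).compl).compl
  have hU : ⋃ n, A n = ⋃ n, partialSups A n := (iSup_partialSups_eq A).symm
  refine ⟨.iUnion fun n => (hA n).1, fun f g hg => ?_⟩
  have hSc : Continuous S := (S.mkContinuous 1 (by simp [hS])).continuous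
  have h1 : Tendsto (fun n => T.cut (hB n).1 f) atTop (𝓝 g) := by
    rw [tendsto_subtype_rng]
    exact tendsto_of_ae_eq_indicator (partialSups A).monotone (fun n => T.coe_cut (hB n).1 f)
      (hU ▸ hg)
  have hm : MeasurableSet (flipSeq ⁻¹' ⋃ n, A n) :=
    measurable_flipSeq (.iUnion fun n => (hA n).1)
  have h2 : Tendsto (fun n => S (T.cut (hB n).1 f)) atTop (𝓝 (T.cut hm (S f))) := by
    rw [tendsto_subtype_rng]
    refine tendsto_of_ae_eq_indicator (B := fun n => flipSeq ⁻¹' partialSups A n)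
      (f := (S f : Lp K 2 T.μ))
      (fun m n hmn => preimage_mono ((partialSups A).monotone hmn))
      (fun n => (hB n).2 f _ (T.coe_cut (hB n).1 f)) ?_
    rw [← preimage_iUnion, ← hU]
    exact T.coe_cut hm (S f)
  rw [tendsto_nhds_unique ((hSc.tendsto g).comp h1) h2]
  exact T.coe_cut hm (S f)

lemma translate_delta_absolutelyContinuous (T : Triple K) (k : ℕ+) : translate (delta k) T.μ ≪ T.μ :=
  (T.quasiInvariant _ (delta_mem k)).1

variable (T) [SecondCountableTopology K]

lemma coe_J'_J (k : ℕ+) (f : T.V) : (T.J' k (T.J k f) : Lp K 2 T.μ) =ᵐ[T.μ]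
    fun x => (-Complex.I * coordSign k x) • (f : Lp K 2 T.μ) x := by
  have hJ : (T.J k f : Lp K 2 T.μ) =ᵐ[T.μ] T.shiftFun (phaseJ k) k (f : Lp K 2 T.μ) :=
    T.coe_shift _ _ k f
  have hd := T.translate_delta_absolutelyContinuous k
  refine (T.coe_shift (measurable_phaseJ' k) (norm_phaseJ' k) k (T.J k f)).trans ?_
  filter_upwards [(quasiMeasurePreserving_add hd).ae hJ, weight_mul_self hd, T.star_c k,
    T.c_mul_star_c k, T.ae_mem_fiber f] with x h1 h2 h3 h4 h5
  rw [shiftFun, h1, shiftFun, add_add_self, ← h3]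
  -- `c_k(x + δ^k)` has become `c_k(x)^*`, so the two operators compose to the projection onto
  -- `V_x`.
  simp only [map_smul, smul_smul]
  have h6 : T.c k x (star (T.c k x) ((f : Lp K 2 T.μ) x)) = (f : Lp K 2 T.μ) x := by
    rw [← mul_apply_eq_comp, h4, starProjection_eq_self h5]
  rw [h6]
  congr 1
  rw [← phaseJ'_mul_phaseJ]
  have h7 : (T.density k x : ℂ) * (T.density k (x + delta k) : ℂ) = 1 := by
    rw [← Complex.ofReal_mul]
    exact_mod_cast h2
  linear_combination (phaseJ' k x * phaseJ k (x + delta k)) * h7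

variable {T}

/-- Twice the indicator of `x_k = 0` is `1 + i J'_k J_k`. Antilinearity turns this into `1 - i J'_k
J_k`, twice the indicator of `x_k = 1`. -/
lemma IsChargeConjugation.flipsIndicator_coord {S : T.V →ₗ⋆[ℂ] T.V}
    (hS : T.IsChargeConjugation S) (k : ℕ+) : FlipsIndicator S {x | x k = 0} := by
  refine ⟨measurable_pi_apply k (measurableSet_singleton 0), fun f g hg => ?_⟩
  have hgf : (2 : ℂ) • g = f + Complex.I • T.J' k (T.J k f) := by
    refine V_ext ?_
    filter_upwards [hg, T.coe_J'_J k f, Lp.coeFn_smul (2 : ℂ) (g : Lp K 2 T.μ),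
      Lp.coeFn_add (f : Lp K 2 T.μ) (Complex.I • T.J' k (T.J k f) : T.V),
      Lp.coeFn_smul Complex.I (T.J' k (T.J k f) : Lp K 2 T.μ)] with x h1 h2 h3 h4 h5
    rw [Submodule.coe_add, h4, Pi.add_apply, Submodule.coe_smul, Submodule.coe_smul, h3, h5,
      Pi.smul_apply, Pi.smul_apply, h1, h2, smul_smul]
    by_cases hx : x k = 0
    · rw [indicator_of_mem (by exact hx), coordSign_of_eq_zero hx, two_smul]
      simp
    · rw [indicator_of_notMem (by exact hx), coordSign_of_ne_zero hx]
      simp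
  have hSg : (2 : ℂ) • S g = S f - Complex.I • T.J' k (T.J k (S f)) := by
    have := congrArg S hgf
    rw [map_add, map_smulₛₗ, map_smulₛₗ, hS.comm_J', hS.comm_J, Complex.conj_I, neg_smul,
      ← sub_eq_add_neg] at this
    simpa [map_ofNat] using this
  have h2 : S g = (1 / 2 : ℂ) • (S f - Complex.I • T.J' k (T.J k (S f))) := by
    rw [← hSg, smul_smul]; norm_num
  rw [h2]
  filter_upwards [T.coe_J'_J k (S f),
    Lp.coeFn_smul (1 / 2 : ℂ) ((S f - Complex.I • T.J' k (T.J k (S f)) : T.V) : Lp K 2 T.μ),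
    Lp.coeFn_sub (S f : Lp K 2 T.μ) (Complex.I • T.J' k (T.J k (S f)) : T.V),
    Lp.coeFn_smul Complex.I (T.J' k (T.J k (S f)) : Lp K 2 T.μ)] with x h1 h2 h3 h4
  rw [Submodule.coe_smul, h2, Pi.smul_apply, Submodule.coe_sub, h3, Pi.sub_apply,
    Submodule.coe_smul, h4, Pi.smul_apply, h1, smul_smul]
  by_cases hx : x k = 0
  · have hx' : flipSeq x k ≠ 0 := by simp [flipSeq, hx]
    rw [indicator_of_notMem (by exact hx'), coordSign_of_eq_zero hx]
    simp
  · have hx' : flipSeq x k = 0 := by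
      rw [flipSeq, Pi.add_apply, (zmod_two_cases (x k)).resolve_left hx]
      rfl
    rw [indicator_of_mem (by exact hx'), coordSign_of_ne_zero hx]
    simp only [mul_neg, Complex.I_mul_I, neg_neg, mul_one, neg_smul, one_smul,
      sub_neg_eq_add]
    rw [← two_smul ℂ, smul_smul]
    norm_num

/-- The sets with the exchange property form a `σ`-algebra that makes every coordinate measurable.
-/
theorem IsChargeConjugation.flipsIndicator {S : T.V →ₗ⋆[ℂ] T.V}
    (hS : T.IsChargeConjugation S) {A : Set X} (hA : MeasurableSet A) : FlipsIndicator S A := by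
  let m : MeasurableSpace X :=
    { MeasurableSet' := FlipsIndicator S
      measurableSet_empty := .empty S
      measurableSet_compl := fun _ h => h.compl
      measurableSet_iUnion := fun _ h => .iUnion hS.norm_map h }
  have hm : (MeasurableSpace.pi : MeasurableSpace X) ≤ m := by
    refine iSup_le fun k => Measurable.comap_le ?_
    have h0 := hS.flipsIndicator_coord k
    refine measurable_to_countable' fun a => ?_
    rcases zmod_two_cases a with rfl | rfl
    · exact h0
    · have hc : (fun x : X => x k) ⁻¹' {1} = {x | x k = 0}ᶜ := by
        ext x
        rcases zmod_two_cases (x k) with h | h <;> simp [h]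
      have h1 : FlipsIndicator S ((fun x : X => x k) ⁻¹' {1}) := hc ▸ h0.compl
      exact h1
  exact hm A hA

end Triple

end Flip

/-! ### Charge conjugations and conjugation fields -/

section Conjugation

lemma val_flipSeq_add_val (x : X) (j : ℕ+) : (flipSeq x j).val + (x j).val = 1 := by
  rw [flipSeq, Pi.add_apply, Pi.one_apply]
  generalize x j = a
  revert a
  decide

lemma partialSum_flipSeq (k : ℕ+) (x : X) :
    partialSum k (flipSeq x) + partialSum k x = k := by
  rw [partialSum, partialSum, ← Finset.sum_add_distrib,
    Finset.sum_congr rfl fun j _ => val_flipSeq_add_val x j]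
  rw [Finset.sum_const, smul_eq_mul, mul_one]
  have : Finset.Iic k = Finset.Icc 1 k := by ext j; simp
  rw [this, PNat.card_Icc]
  simp

lemma partialSumBefore_flipSeq (k : ℕ+) (x : X) :
    partialSumBefore k (flipSeq x) + partialSumBefore k x + 1 = k := by
  have h1 := partialSum_flipSeq k x
  have h2 := val_flipSeq_add_val x k
  rw [partialSum_eq, partialSum_eq] at h1
  omega

/-- Flipping the `k - 1` coordinates before `k` gives `(-1)^(k-1)`, and conjugating `-i` gives one
more sign. For `phaseJ'` all `k` signs come from the flip, so both families lead to the same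
relation. -/
lemma conj_phaseJ_flipSeq (k : ℕ+) (x : X) :
    (starRingEnd ℂ) (phaseJ k (flipSeq x)) = (-1) ^ (k : ℕ) * phaseJ k x := by
  rw [← partialSumBefore_flipSeq k x, phaseJ, phaseJ, pow_succ, pow_add]
  have : ((-1 : ℂ) ^ partialSumBefore k x) * (-1) ^ partialSumBefore k x = 1 := by
    rw [← mul_pow]; simp
  simp only [map_mul, map_neg, Complex.conj_I, map_pow, map_one]
  linear_combination (-Complex.I * (-1) ^ partialSumBefore k (flipSeq x)) * this

lemma conj_phaseJ'_flipSeq (k : ℕ+) (x : X) :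
    (starRingEnd ℂ) (phaseJ' k (flipSeq x)) = (-1) ^ (k : ℕ) * phaseJ' k x := by
  rw [← partialSum_flipSeq k x, phaseJ', phaseJ', pow_add]
  have : ((-1 : ℂ) ^ partialSum k x) * (-1) ^ partialSum k x = 1 := by
    rw [← mul_pow]; simp
  simp only [map_neg, map_pow, map_one]
  linear_combination (-(-1) ^ partialSum k (flipSeq x)) * this

lemma weight_ne_zero {μ : Measure X} [SigmaFinite μ] {d : X} (hd : translate d μ ≪ μ) :
    ∀ᵐ x ∂μ, (weight μ d x : ℂ) ≠ 0 := by
  filter_upwards [weight_mul_self hd] with x hx h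
  rw [Complex.ofReal_eq_zero] at h
  simp [h] at hx

lemma weight_mul_weight_comm {μ : Measure X} [SigmaFinite μ] {d e : X} (hd : translate d μ ≪ μ)
    (he : translate e μ ≪ μ) : ∀ᵐ x ∂μ, (weight μ d x : ℂ) * weight μ e (x + d) =
      weight μ e x * weight μ d (x + e) := by
  filter_upwards [weight_mul_weight hd he, weight_mul_weight he hd] with x h1 h2
  rw [← Complex.ofReal_mul, ← Complex.ofReal_mul, h1, h2, add_comm]

variable {K : Type*} [NormedAddCommGroup K] [InnerProductSpace ℂ K] [CompleteSpace K]

namespace Triple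

open Filter Set Topology

variable {T : Triple K}

/-- A field of antilinear bijections `V_{x̌} → V_x` identifies the dimensions. -/
lemma IsConjugationField.ae_ν_eq {r : X → K →L⋆[ℂ] K} (hr : T.IsConjugationField r)
    (hd : translate 1 T.μ ≪ T.μ) : ∀ᵐ x ∂T.μ, T.ν (flipSeq x) = T.ν x := by
  have hq := quasiMeasurePreserving_add hd
  filter_upwards [hr.mapsTo, hq.ae hr.mapsTo, hr.apply_apply, hq.ae hr.apply_apply]
    with x h1 h2 h3 h4
  change ∀ v ∈ T.fiber (flipSeq (flipSeq x)), r (flipSeq x) v ∈ T.fiber (flipSeq x) at h2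
  change ∀ v ∈ T.fiber (flipSeq x), r (flipSeq x) (r (flipSeq (flipSeq x)) v) = v at h4
  rw [flipSeq_flipSeq] at h2 h4
  let j : T.fiber (flipSeq x) ≃+ T.fiber x :=
    { toFun := fun v => ⟨r x v, h1 v v.2⟩
      invFun := fun v => ⟨r (flipSeq x) v, h2 v v.2⟩
      left_inv := fun v => Subtype.ext (h4 v v.2)
      right_inv := fun v => Subtype.ext (h3 v v.2)
      map_add' := fun v w => Subtype.ext (map_add (r x) (v : K) w) }
  rw [ν, ν, rank_eq_of_equiv_equiv (starRingEnd ℂ) j star_involutive.bijective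
    fun a v => Subtype.ext (map_smulₛₗ (r x) a (v : K))]

/-- The function `x ↦ √(dμ̌(x)/dμ(x)) r(x) f(x̌)`. -/
def conjFun (T : Triple K) (r : X → K →L⋆[ℂ] K) (f : X → K) (x : X) : K :=
  (weight T.μ 1 x : ℂ) • r x (f (x + 1))

lemma IsConjugationField.norm_conjFun {r : X → K →L⋆[ℂ] K} (hr : T.IsConjugationField r)
    (hd : translate 1 T.μ ≪ T.μ)
    (f : T.V) : ∀ᵐ x ∂T.μ, ‖conjFun T r (f : Lp K 2 T.μ) x‖ =
      ‖weightedTranslateFun T.μ 1 (f : Lp K 2 T.μ) x‖ := by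
  filter_upwards [hr.norm_map, (quasiMeasurePreserving_add hd).ae (T.ae_mem_fiber f)] with x h1 h2
  rw [conjFun, weightedTranslateFun, norm_smul, norm_smul, h1 _ h2]

variable [SecondCountableTopology K]

lemma coe_shift_apply {φ : X → ℂ} (hφ : Measurable φ) (hφ1 : ∀ x, ‖φ x‖ = 1) (k : ℕ+)
    (f : T.V) : ∀ᵐ x ∂T.μ, (T.shift hφ hφ1 k f : Lp K 2 T.μ) x =
      φ x • T.c k x ((weight T.μ (delta k) x : ℂ) • (f : Lp K 2 T.μ) (x + delta k)) :=
  T.coe_shift hφ hφ1 k f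

variable {S : T.V →ₗ⋆[ℂ] T.V}

/-- If `A` is null, the truncation of `S f` to `A` is `0`. Applying `S` shows that `f = S (S f)`
vanishes on `Ǎ`; since `f` is arbitrary, `Ǎ` is null. -/
lemma IsChargeConjugation.translate_one_absolutelyContinuous (hS : T.IsChargeConjugation S) :
    translate 1 T.μ ≪ T.μ := by
  refine Measure.AbsolutelyContinuous.mk fun A hA hA0 => ?_
  rw [translate, Measure.map_apply (measurable_add_right 1) hA]
  refine T.measure_eq_zero_of_forall fun f => ?_
  have h := (hS.flipsIndicator hA).2 (S f) 0 <| by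
    filter_upwards [Lp.coeFn_zero K 2 T.μ, measure_eq_zero_iff_ae_notMem.1 hA0] with x h1 h2
    rw [indicator_of_notMem h2]
    exact h1
  rw [map_zero, hS.apply_apply] at h
  filter_upwards [Lp.coeFn_zero K 2 T.μ, h] with x h1 h2 hx
  rw [indicator_of_mem (by exact hx)] at h2
  rw [← h2]
  exact h1

/-- A charge conjugation acts by `(S f)(x) = √(dμ̌(x)/dμ(x)) r(x) f(x̌)` for a measurable family of
antilinear contractions `r(x)`. -/
lemma IsChargeConjugation.exists_field (hS : T.IsChargeConjugation S) :
    ∃ r : X → K →L⋆[ℂ] K, (∀ v, StronglyMeasurable fun x => r x v) ∧ (∀ x v, ‖r x v‖ ≤ ‖v‖) ∧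
      ∀ f : T.V, ∀ᵐ x ∂T.μ, (S f : Lp K 2 T.μ) x =
        (weight T.μ 1 x : ℂ) • r x ((f : Lp K 2 T.μ) (x + 1)) := by
  have hd := hS.translate_one_absolutelyContinuous
  let U : Lp K 2 T.μ →ₗᵢ[ℂ] Lp K 2 T.μ := weightedTranslate hd
  -- `U` undoes the flip in `S`, so that `R` commutes with indicators; the projection extends the
  -- operator to all of `L²(X, μ; K)`.
  let R : Lp K 2 T.μ →ₗ⋆[ℂ] Lp K 2 T.μ := T.V.subtype.comp (S.comp (T.proj.comp U.toLinearMap))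
  have hRU (f : Lp K 2 T.μ) : R f = S (T.proj (U f)) := rfl
  have hR1 (f : Lp K 2 T.μ) : ‖R f‖ ≤ ‖f‖ := by
    calc ‖R f‖ = ‖S (T.proj (U f))‖ := rfl
      _ = ‖T.proj (U f)‖ := hS.norm_map _
      _ ≤ ‖U f‖ := T.norm_proj_le _
      _ = ‖f‖ := U.norm_map f
  have hR : CommutesWithIndicators R := by
    intro A hA f g hgf
    have h1 := (hS.flipsIndicator (measurable_flipSeq hA)).2 (T.proj (U f)) (T.proj (U g)) <| by
      filter_upwards [T.coe_proj (U f), T.coe_proj (U g), coeFn_weightedTranslate hd f,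
        coeFn_weightedTranslate hd g, weightedTranslateFun_congr hd hgf] with x h1 h2 h3 h4 h5
      have h6 : U g x = weightedTranslateFun T.μ 1 (A.indicator f) x := h4.trans h5
      have h7 : U f x = weightedTranslateFun T.μ 1 f x := h3
      rw [h2, h6, weightedTranslateFun]
      by_cases hx : flipSeq x ∈ A
      · rw [indicator_of_mem (by exact hx), indicator_of_mem (by exact hx), h1, h7,
          weightedTranslateFun]
      · rw [indicator_of_notMem (by exact hx), indicator_of_notMem (by exact hx), smul_zero,
          map_zero]
    have h2 : flipSeq ⁻¹' (flipSeq ⁻¹' A) = A := by ext x; simp [flipSeq_flipSeq]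
    rw [h2] at h1
    exact h1
  obtain ⟨r, hrm, hr1, hr⟩ := hR.exists_field hR1
  refine ⟨r, hrm, hr1, fun f => ?_⟩
  have h1 : (S f : Lp K 2 T.μ) = R (U f) := by
    rw [hRU, weightedTranslate_self_apply, proj_coe]
  rw [h1]
  filter_upwards [hr (U f), coeFn_weightedTranslate hd (f : Lp K 2 T.μ)] with x h2 h3
  have h4 : U f x = weightedTranslateFun T.μ 1 f x := h3
  rw [h2, h4, weightedTranslateFun, map_smulₛₗ, Complex.conj_ofReal]

theorem IsChargeConjugation.exists_isConjugationField (hS : T.IsChargeConjugation S) :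
    ∃ r : X → K →L⋆[ℂ] K, T.IsConjugationField r := by
  obtain ⟨r, hrm, hr1, hr⟩ := hS.exists_field
  have hd := hS.translate_one_absolutelyContinuous
  have hq := quasiMeasurePreserving_add hd
  have hinv : ∀ᵐ x ∂T.μ, ∀ v ∈ T.fiber x, r x (r (flipSeq x) v) = v := by
    have h0 : translate 0 T.μ ≪ T.μ := by rw [translate_zero]
    have := T.ae_forall_mem_fiber h0 (p := fun x v => r x (r (x + 1) v) = v)
      (fun x => isClosed_eq (by fun_prop) continuous_id) fun f => by
        filter_upwards [hr (S f), hq.ae (hr f), weight_mul_self hd] with x h1 h2 h3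
        rw [hS.apply_apply, h2, add_add_self, map_smulₛₗ, Complex.conj_ofReal, smul_smul,
          ← Complex.ofReal_mul, h3, Complex.ofReal_one, one_smul] at h1
        rw [add_zero, ← h1]
    simpa [flipSeq] using this
  refine ⟨r, hrm, ?_, ?_, hinv, fun k => ?_⟩
  · refine T.ae_forall_mem_fiber hd (p := fun x v => r x v ∈ T.fiber x)
      (fun x => (T.fiber x).isClosed.preimage (r x).continuous) fun f => ?_
    filter_upwards [hr f, T.ae_mem_fiber (S f), weight_ne_zero hd] with x h1 h2 h3
    rw [h1] at h2
    exact ((T.fiber x).toSubmodule.smul_mem_iff h3).1 h2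
  · filter_upwards [hq.ae hinv] with x hx v hv
    -- `r x` and `r (x + 1)` are contractions inverse to each other on the fibers, hence isometric
    -- there.
    refine le_antisymm (hr1 x v) ?_
    have h := hx v hv
    rw [flipSeq, add_add_self] at h
    calc ‖v‖ = ‖r (x + 1) (r x v)‖ := by rw [h]
      _ ≤ ‖r x v‖ := hr1 _ _
  -- Evaluate `S (J_k f) = J_k (S f)` at `x`. By the chain rule both sides carry the nonzero factor
  -- `weight T.μ (1 + delta k) x * phaseJ k x`, which is cancelled; the left side has an extra
  -- `(-1)^k` from the phase.
  · have hk := T.translate_delta_absolutelyContinuous k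
    have := T.ae_forall_mem_fiber (translate_add_absolutelyContinuous hd hk)
      (p := fun x v => r x (T.c k (x + 1) v) = (-1 : ℂ) ^ (k : ℕ) • T.c k x (r (x + delta k) v))
      (fun x => isClosed_eq (by fun_prop) (by fun_prop)) fun f => by
        have hJ := coe_shift_apply (T := T) (measurable_phaseJ k) (norm_phaseJ k) k
        filter_upwards [hr (T.J k f), hq.ae (hJ f), hJ (S f),
          (quasiMeasurePreserving_add hk).ae (hr f), weight_mul_weight_comm hd hk,
          weight_ne_zero (translate_add_absolutelyContinuous hd hk), weight_mul_weight hd hk]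
          with x h1 h2 h3 h4 h5 h6 h7
        have h8 : (S (T.J k f) : Lp K 2 T.μ) x = (T.J k (S f) : Lp K 2 T.μ) x := by
          rw [hS.comm_J]
        have h9 := conj_phaseJ_flipSeq k x
        rw [flipSeq] at h9
        rw [h1, J, h2, h3, h4] at h8
        simp only [map_smulₛₗ, map_mul, RingHom.id_apply, Complex.conj_ofReal, smul_smul, h9] at h8
        rw [← add_assoc]
        rw [add_right_comm x (delta k) 1] at h8
        have h10 : (weight T.μ (1 + delta k) x : ℂ) * phaseJ k x ≠ 0 :=
          mul_ne_zero h6 (norm_ne_zero_iff.1 (by simp [norm_phaseJ]))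
        have h11 : (weight T.μ 1 x : ℂ) * weight T.μ (delta k) (x + 1) =
            weight T.μ (1 + delta k) x := by
          rw [← Complex.ofReal_mul, h7]
        have h12 : ((-1 : ℂ) ^ (k : ℕ)) * (-1) ^ (k : ℕ) = 1 := by
          rw [← mul_pow]; simp
        refine smul_right_injective K h10 ?_
        have h13 := congrArg (fun v => ((-1 : ℂ) ^ (k : ℕ)) • v) h8
        simp only [smul_smul] at h13 ⊢
        convert h13 using 2
        · linear_combination (-phaseJ k x * weight T.μ (1 + delta k) x) * h12 -
            (phaseJ k x * (-1) ^ (k : ℕ) * (-1) ^ (k : ℕ)) * h11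
        · linear_combination (phaseJ k x * (-1) ^ (k : ℕ)) * (h5 - h11)
    simpa only [flipSeq, ← add_assoc] using this

/-! ### The charge conjugation defined by a conjugation field -/

variable {r : X → K →L⋆[ℂ] K}

lemma IsConjugationField.memLp_conjFun (hr : T.IsConjugationField r)
    (hd : translate 1 T.μ ≪ T.μ) (f : T.V) : MemLp (conjFun T r (f : Lp K 2 T.μ)) 2 T.μ := by
  refine (memLp_weightedTranslateFun hd (f : Lp K 2 T.μ)).mono ?_
    ((hr.norm_conjFun hd f).mono fun x hx => hx.le)
  refine ((Complex.measurable_ofReal.comp (measurable_weight T.μ 1)).stronglyMeasurable.smul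
    ?_).aestronglyMeasurable
  exact stronglyMeasurable_field_apply (r := fun x => r x) (fun x => (r x).continuous) hr.measurable
    ((Lp.stronglyMeasurable (f : Lp K 2 T.μ)).comp_measurable (measurable_add_right 1))

lemma IsConjugationField.toLp_conjFun_mem (hr : T.IsConjugationField r)
    (hd : translate 1 T.μ ≪ T.μ) (f : T.V) : (hr.memLp_conjFun hd f).toLp ∈ T.V := by
  change ∀ᵐ x ∂T.μ, _ ∈ T.fiber x
  filter_upwards [(hr.memLp_conjFun hd f).coeFn_toLp, hr.mapsTo,
    (quasiMeasurePreserving_add hd).ae (T.ae_mem_fiber f)] with x h1 h2 h3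
  rw [h1]
  exact (T.fiber x).toSubmodule.smul_mem _ (h2 _ h3)

/-- The operator `(S f)(x) = √(dμ̌(x)/dμ(x)) r(x) f(x̌)` on `V(μ, ν, 𝒞)`. -/
def conj (hr : T.IsConjugationField r) (hd : translate 1 T.μ ≪ T.μ) : T.V →ₗ⋆[ℂ] T.V where
  toFun f := ⟨(hr.memLp_conjFun hd f).toLp, hr.toLp_conjFun_mem hd f⟩
  map_add' f g := by
    apply Subtype.ext
    change (hr.memLp_conjFun hd (f + g)).toLp =
      (hr.memLp_conjFun hd f).toLp + (hr.memLp_conjFun hd g).toLp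
    rw [← MemLp.toLp_add, MemLp.toLp_eq_toLp_iff]
    filter_upwards [(quasiMeasurePreserving_add hd).ae (Lp.coeFn_add (f : Lp K 2 T.μ) g)]
      with x hx
    simp only [conjFun, Pi.add_apply, Submodule.coe_add, hx, smul_add, map_add]
  map_smul' a f := by
    apply Subtype.ext
    change (hr.memLp_conjFun hd (a • f)).toLp =
      (starRingEnd ℂ) a • (hr.memLp_conjFun hd f).toLp
    rw [← MemLp.toLp_const_smul, MemLp.toLp_eq_toLp_iff]
    filter_upwards [(quasiMeasurePreserving_add hd).ae (Lp.coeFn_smul a (f : Lp K 2 T.μ))]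
      with x hx
    simp only [conjFun, Pi.smul_apply, Submodule.coe_smul, hx, map_smulₛₗ]
    rw [smul_comm]

lemma coe_conj (hr : T.IsConjugationField r) (hd : translate 1 T.μ ≪ T.μ) (f : T.V) :
    ∀ᵐ x ∂T.μ, (conj hr hd f : Lp K 2 T.μ) x =
      (weight T.μ 1 x : ℂ) • r x ((f : Lp K 2 T.μ) (x + 1)) :=
  (hr.memLp_conjFun hd f).coeFn_toLp

/-- Two signs `(-1)^k` cancel, one from the phase and one from `apply_c`; the weights of the flip
and of `δ^k` commute. The phase is general so as to cover both `J k` and `J' k`. -/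
lemma conj_shift (hr : T.IsConjugationField r) (hd : translate 1 T.μ ≪ T.μ) {φ : X → ℂ}
    (hφ : Measurable φ) (hφ1 : ∀ x, ‖φ x‖ = 1) (k : ℕ+)
    (hφk : ∀ x, (starRingEnd ℂ) (φ (flipSeq x)) = (-1) ^ (k : ℕ) * φ x) (f : T.V) :
    conj hr hd (T.shift hφ hφ1 k f) = T.shift hφ hφ1 k (conj hr hd f) := by
  have hk := T.translate_delta_absolutelyContinuous k
  have hJ := coe_shift_apply (T := T) hφ hφ1 k
  refine V_ext ?_
  filter_upwards [coe_conj hr hd (T.shift hφ hφ1 k f),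
    (quasiMeasurePreserving_add hd).ae (hJ f), hJ (conj hr hd f),
    (quasiMeasurePreserving_add hk).ae (coe_conj hr hd f), weight_mul_weight_comm hd hk,
    hr.apply_c k,
    (quasiMeasurePreserving_add (translate_add_absolutelyContinuous hd hk)).ae (T.ae_mem_fiber f)]
    with x h1 h2 h3 h4 h5 h6 h7
  have h9 := hφk x
  rw [← add_assoc] at h7
  have h8 := h6 _ h7
  rw [flipSeq] at h8 h9
  rw [h1, h2, h3, h4]
  simp only [map_smulₛₗ, map_mul, RingHom.id_apply, Complex.conj_ofReal, smul_smul, h9, h8]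
  rw [add_right_comm x (delta k) 1]
  congr 1
  have h10 : ((-1 : ℂ) ^ (k : ℕ)) * (-1) ^ (k : ℕ) = 1 := by
    rw [← mul_pow]; simp
  linear_combination φ x * h5 +
    (φ x * weight T.μ 1 x * weight T.μ (delta k) (x + 1)) * h10

theorem isChargeConjugation_conj (hr : T.IsConjugationField r) (hd : translate 1 T.μ ≪ T.μ) :
    T.IsChargeConjugation (conj hr hd) where
  comm_J k f := conj_shift hr hd _ _ k (conj_phaseJ_flipSeq k) f
  comm_J' k f := conj_shift hr hd _ _ k (conj_phaseJ'_flipSeq k) f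
  apply_apply f := by
    refine V_ext ?_
    filter_upwards [coe_conj hr hd (conj hr hd f),
      (quasiMeasurePreserving_add hd).ae (coe_conj hr hd f), weight_mul_self hd, hr.apply_apply,
      T.ae_mem_fiber f] with x h1 h2 h3 h4 h5
    have h6 := h4 _ h5
    rw [flipSeq] at h6
    rw [h1, h2, add_add_self, map_smulₛₗ, Complex.conj_ofReal, smul_smul, ← Complex.ofReal_mul, h3,
      Complex.ofReal_one, one_smul, h6]
  norm_map f := by
    change ‖(hr.memLp_conjFun hd f).toLp‖ = ‖(f : Lp K 2 T.μ)‖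
    rw [Lp.norm_toLp, eLpNorm_congr_norm_ae (hr.norm_conjFun hd f),
      eLpNorm_weightedTranslateFun hd (Lp.stronglyMeasurable _), Lp.norm_def]

end Triple

end Conjugation

end GardingWightman

end

theorem theorem3p2 {K : Type*} [NormedAddCommGroup K] [InnerProductSpace ℂ K] [CompleteSpace K]
    [SecondCountableTopology K] (T : GardingWightman.Triple K) :
    (∃ U : Set T.V, T.IsInvariantRealForm U) ↔
      GardingWightman.EquivMeasure T.μ (GardingWightman.flipMeasure T.μ) ∧
      (∀ᵐ x ∂T.μ, T.ν (GardingWightman.flipSeq x) = T.ν x) ∧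
      ∃ r : GardingWightman.X → K →L⋆[ℂ] K, T.IsConjugationField r := by
  constructor
  · rintro ⟨U, S, hS, -⟩
    have hd := hS.translate_one_absolutelyContinuous
    obtain ⟨r, hr⟩ := hS.exists_isConjugationField
    -- `flipMeasure` is by definition the translate by `1`; one absolute continuity implies the
    -- other.
    exact ⟨⟨GardingWightman.absolutelyContinuous_translate hd, hd⟩, hr.ae_ν_eq hd, r, hr⟩
  · rintro ⟨hμ, -, r, hr⟩
    exact ⟨_, _, GardingWightman.Triple.isChargeConjugation_conj hr hμ.2, rfl⟩
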